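/- Let $\overline{\mathbf Q}$ be an algebraic closure of $\mathbf Q$. For a number field $K\subset\overline{\mathbf Q}$ let $M_K$ be its set of places with the discrete topology; for $v\in M_K$ let $\|\cdot\|_v$ be the absolute value in the class $v$ that extends the usual real absolute value or a usual $p$-adic absolute value ($\|p\|=1/p$) of $\mathbf Q$. Let $Y=\varprojlim_K M_K$ (with respect to restriction of places, with the projective limit topology) be the space of places of $\overline{\mathbf Q}$, and write $Y(K,v)$ for the set of $y\in Y$ lying over $v\in M_K$. For $y\in Y$ and $\alpha\in\overline{\mathbf Q}$ let $\|\alpha\|_y$ be the absolute value of $\alpha$ at the place of $\mathbf Q(\alpha)$ below $y$. Let $\lambda$ be the Allcock–Vaaler measure, i.e. the Borel measure on $Y$ with $\lambda(Y(K,v))=[K_v:\mathbf Q_v]/[K:\mathbf Q]$ for all number fields $K$ and all $v\in M_K$; it is the sum, over the places $v$ of $\mathbf Q$, of the images of the Haar probability measure of $\mathrm{Gal}(\overline{\mathbf Q}/\mathbf Q)$ under $\sigma\mapsto\sigma y_v$, where $y_v$ is any place over $v$ and $\|\alpha\|_{\sigma y}=\|\sigma^{-1}\alpha\|_y$. For $\alpha\in\overline{\mathbf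 Q}^\times$ let $f_\alpha:Y\to\mathbf R$, $f_\alpha(y)=\log\|\alpha\|_y$, and let $\mathcal F=\{f_\alpha:\alpha\in\overline{\mathbf Q}^\times\}$, a $\mathbf Q$-vector space of continuous compactly supported functions, isomorphic to $\overline{\mathbf Q}^\times$ modulo roots of unity. Let $\mathcal F_p$ be the completion of $\mathcal F$ in the $L^p(\lambda)$ norm, realized as the closure of $\mathcal F$ in $L^p(Y,\lambda)$ if $1\le p<\infty$, and as the closure of $\mathcal F$ in $C_0(Y)$ with the supremum norm if $p=\infty$. **Theorem 1.** Let $S\subset Y$ be a compact open set containing all archimedean places. Then, for every $1\le p\le\infty$, the space of algebraic $S$-units $$\mathcal F(S)=\{f\in\mathcal F:\operatorname{supp} f\subseteq S\}$$ is contained and dense in the closed vector space $$\mathcal F_p(S,0)=\Big\{f\in\mathcal F_p:\operatorname{supp} f\subseteq S,\ \int_S f\,d\lambda=0\Big\}.$$ Moreover $\mathcal F_p(S,0)$ consists of all $f\in L^p(Y,\lambda)$ (if $p<\infty$), respectively all $f\in C_0(Y)$ (if $p=\infty$), with $\operatorname{supp} f\subseteq S$ and $\int_S f\,d\lambda=0$.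 -/

import Mathlib

open MeasureTheory Topology
open scoped ENNReal ZeroAtInfty

noncomputable section

/-- A fixed algebraic closure of `ℚ`. -/
abbrev Qbar : Type := AlgebraicClosure ℚ

instance : Algebra.IsAlgebraic ℚ Qbar := AlgebraicClosure.isAlgebraic ℚ

/-- The absolute Galois group of `ℚ`, a compact group for the Krull topology. -/
abbrev GalQ : Type := Gal(Qbar/ℚ)

instance : IsAlgClosure ℚ Qbar := ⟨inferInstance, inferInstance⟩

instance : IsGalois ℚ Qbar := IsAlgClosure.isGalois ℚ Qbar

/-- A place of a field `F` algebraic over `ℚ`, represented by the unique absolute value in its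
class which extends one of the usual absolute values of `ℚ` (the real one or a `p`-adic one). -/
def Place (F : Type) [Field F] [Algebra ℚ F] : Type :=
  {v : AbsoluteValue F ℝ //
    (∀ q : ℚ, v (algebraMap ℚ F q) = Rat.AbsoluteValue.real q) ∨
    ∃ (p : ℕ) (_ : Fact p.Prime), ∀ q : ℚ, v (algebraMap ℚ F q) = Rat.AbsoluteValue.padic p q}

namespace Place

/-- The place is archimedean: it lies over the real place of `ℚ`. -/
def IsArchimedean {F : Type} [Field F] [Algebra ℚ F] (v : Place F) : Prop :=
  ∀ q : ℚ, v.1 (algebraMap ℚ F q) = Rat.AbsoluteValue.real q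

/-- Pull back a place along a field homomorphism over `ℚ` (for an inclusion: restrict it). -/
def comap {E F : Type} [Field E] [Algebra ℚ E] [Field F] [Algebra ℚ F]
    (φ : E →ₐ[ℚ] F) (v : Place F) : Place E :=
  ⟨v.1.comp (f := φ.toRingHom) φ.toRingHom.injective, by
    rcases v.2 with h | ⟨p, hp, h⟩
    · left
      intro q
      exact (congrArg v.1 (φ.commutes q)).trans (h q)
    · right
      exact ⟨p, hp, fun q => (congrArg v.1 (φ.commutes q)).trans (h q)⟩⟩

/-- The set of places of a field carries the discrete topology. -/
instance {F : Type} [Field F] [Algebra ℚ F] : TopologicalSpace (Place F) := ⊥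

end Place

/-- The number fields, as the finite extensions of `ℚ` inside `Qbar`. -/
abbrev NumField : Type := {K : IntermediateField ℚ Qbar // FiniteDimensional ℚ K}

/-- The number field `ℚ`. -/
def rationals : NumField := ⟨⊥, inferInstance⟩

/-- The number field generated by an algebraic number. -/
def generatedBy (α : Qbar) : NumField :=
  ⟨IntermediateField.adjoin ℚ {α},
    IntermediateField.adjoin.finiteDimensional (Algebra.IsIntegral.isIntegral α)⟩

/-- The space of places of `Qbar`: the projective limit of the discrete spaces of places of
number fields, under restriction of places. -/
def PlaceSpace : Type :=
  {y : ∀ K : NumField, Place K.1 //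
    ∀ (K L : NumField) (h : K.1 ≤ L.1), (y L).comap (IntermediateField.inclusion h) = y K}

namespace PlaceSpace

/-- The projective limit topology. -/
instance : TopologicalSpace PlaceSpace :=
  inferInstanceAs (TopologicalSpace {y : ∀ K : NumField, Place K.1 //
    ∀ (K L : NumField) (h : K.1 ≤ L.1), (y L).comap (IntermediateField.inclusion h) = y K})

instance : MeasurableSpace PlaceSpace := borel PlaceSpace

instance : BorelSpace PlaceSpace := ⟨rfl⟩

/-- The set `Y(K, v)` of the places of `Qbar` lying over the place `v` of `K`. -/
def above (K : NumField) (v : Place K.1) : Set PlaceSpace := {y | y.1 K = v}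

/-- The set of archimedean places of `Qbar`: those over the real place of `ℚ`. -/
def archimedean : Set PlaceSpace := {y | (y.1 rationals).IsArchimedean}

/-- The absolute value `‖α‖_y`. -/
def norm (y : PlaceSpace) (α : Qbar) : ℝ :=
  (y.1 (generatedBy α)).1 ⟨α, IntermediateField.mem_adjoin_simple_self ℚ α⟩

/-- `‖α‖_y` can be computed in any number field containing `α`. -/
lemma norm_eq (y : PlaceSpace) (K : NumField) (α : K.1) : y.norm α = (y.1 K).1 α := by
  have h : (generatedBy (α : Qbar)).1 ≤ K.1 :=
    IntermediateField.adjoin_simple_le_iff.2 α.2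
  have := y.2 _ K h
  unfold norm
  rw [← this]
  rfl

lemma norm_mul (y : PlaceSpace) (α β : Qbar) : y.norm (α * β) = y.norm α * y.norm β := by
  have hfin : FiniteDimensional ℚ
      ((generatedBy α).1 ⊔ (generatedBy β).1 : IntermediateField ℚ Qbar) := by
    have := (generatedBy α).2
    have := (generatedBy β).2
    infer_instance
  let K : NumField := ⟨(generatedBy α).1 ⊔ (generatedBy β).1, hfin⟩
  let a : K.1 := ⟨α, (le_sup_left : (generatedBy α).1 ≤ K.1)
    (IntermediateField.mem_adjoin_simple_self ℚ α)⟩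
  let b : K.1 := ⟨β, (le_sup_right : (generatedBy β).1 ≤ K.1)
    (IntermediateField.mem_adjoin_simple_self ℚ β)⟩
  have h1 := norm_eq y K a
  have h2 := norm_eq y K b
  have h3 := norm_eq y K (a * b)
  have h4 : y.norm (α * β) = (y.1 K).1 (a * b) := h3
  rw [h4, map_mul, ← h1, ← h2]

lemma norm_one (y : PlaceSpace) : y.norm 1 = 1 := by
  have h : y.norm 1 = (y.1 rationals).1 1 := norm_eq y rationals 1
  rw [h, map_one]

lemma norm_ne_zero (y : PlaceSpace) (α : Qbarˣ) : y.norm α ≠ 0 := by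
  intro h
  have h1 := norm_mul y α (α⁻¹ : Qbarˣ)
  rw [h, zero_mul, Units.mul_inv, norm_one] at h1
  exact one_ne_zero h1

/-- The point of the projective limit given by a place of `Qbar`. -/
def ofPlace (w : Place Qbar) : PlaceSpace :=
  ⟨fun K => w.comap K.1.val, fun _ _ _ => rfl⟩

end PlaceSpace

/-- The function `f_α : y ↦ log ‖α‖_y`. -/
def logNorm (α : Qbarˣ) (y : PlaceSpace) : ℝ := Real.log (y.norm α)

lemma logNorm_mul (α β : Qbarˣ) : logNorm (α * β) = logNorm α + logNorm β := by
  funext y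
  simp only [logNorm, Pi.add_apply, Units.val_mul, PlaceSpace.norm_mul]
  exact Real.log_mul (y.norm_ne_zero α) (y.norm_ne_zero β)

lemma logNorm_one : logNorm 1 = 0 := by
  funext y
  simp [logNorm, PlaceSpace.norm_one]

/-- `α ↦ f_α` as a group homomorphism. -/
def logNormHom : Additive Qbarˣ →+ (PlaceSpace → ℝ) where
  toFun α := logNorm α.toMul
  map_zero' := logNorm_one
  map_add' a b := logNorm_mul a.toMul b.toMul

lemma exists_logNorm_smul (c : ℚ) (α : Qbarˣ) :
    ∃ β : Qbarˣ, logNorm β = c • logNorm α := by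
  obtain ⟨z, hz⟩ := IsAlgClosed.exists_pow_nat_eq ((α ^ c.num : Qbarˣ) : Qbar) c.den_pos
  have hz0 : z ≠ 0 := by
    rintro rfl
    rw [zero_pow c.den_nz] at hz
    exact (α ^ c.num).ne_zero hz.symm
  refine ⟨Units.mk0 z hz0, ?_⟩
  have h : Units.mk0 z hz0 ^ c.den = α ^ c.num := Units.ext (by simpa using hz)
  have h1 : c.den • logNorm (Units.mk0 z hz0) = c.num • logNorm α := by
    have h2 := congrArg (fun u : Qbarˣ => logNormHom (Additive.ofMul u)) h
    simp only [ofMul_pow, ofMul_zpow, map_nsmul, map_zsmul] at h2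
    exact h2
  funext y
  have h3 := congrFun h1 y
  simp only [Pi.smul_apply, nsmul_eq_mul, zsmul_eq_mul] at h3
  have hd : (c.den : ℝ) ≠ 0 := by exact_mod_cast c.den_nz
  have hc : (c : ℝ) = (c.num : ℝ) / (c.den : ℝ) := by exact_mod_cast (Rat.num_div_den c).symm
  rw [Pi.smul_apply, Rat.smul_def, hc]
  field_simp
  simpa [mul_comm] using h3

/-- The `ℚ`-vector space `F` of the functions `f_α`, for `α` a nonzero algebraic number. -/
def algFun : Submodule ℚ (PlaceSpace → ℝ) where
  carrier := Set.range logNorm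
  zero_mem' := ⟨1, logNorm_one⟩
  add_mem' := by
    rintro _ _ ⟨α, rfl⟩ ⟨β, rfl⟩
    exact ⟨α * β, logNorm_mul α β⟩
  smul_mem' := by
    rintro c _ ⟨α, rfl⟩
    exact exists_logNorm_smul c α

/-- The `ℚ`-vector space `F(S)` of algebraic `S`-units modulo torsion: the functions in `F` with
support in `S`. -/
def sUnitFun (S : Set PlaceSpace) : Submodule ℚ (PlaceSpace → ℝ) where
  carrier := {f | f ∈ algFun ∧ tsupport f ⊆ S}
  zero_mem' := ⟨zero_mem _, by simp⟩
  add_mem' := fun hf hg => ⟨add_mem hf.1 hg.1,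
    (tsupport_add _ _).trans (Set.union_subset hf.2 hg.2)⟩
  smul_mem' := fun c f hf => ⟨Submodule.smul_mem _ c hf.1,
    (closure_mono (Function.support_const_smul_subset c f)).trans hf.2⟩

/-- The archimedean place of `Qbar` obtained from an embedding into `ℂ`. -/
def complexPlace : Place Qbar :=
  ⟨(NormedField.toAbsoluteValue ℂ).comp
      (f := (IsAlgClosed.lift (R := ℚ) (S := Qbar) (M := ℂ)).toRingHom) (RingHom.injective _), by
    left
    intro q
    exact (congrArg (fun z : ℂ => ‖z‖)
      ((IsAlgClosed.lift (R := ℚ) (S := Qbar) (M := ℂ)).commutes q)).trans (by simp)⟩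

/-- The place of `Qbar` over `p` obtained from an embedding into an algebraic closure of the
`p`-adic numbers. -/
def padicPlace (p : ℕ) [Fact p.Prime] : Place Qbar :=
  ⟨(NormedField.toAbsoluteValue (PadicAlgCl p)).comp
      (f := (IsAlgClosed.lift (R := ℚ) (S := Qbar) (M := PadicAlgCl p)).toRingHom)
      (RingHom.injective _), by
    right
    refine ⟨p, inferInstance, fun q => ?_⟩
    have h : ‖algebraMap ℚ_[p] (PadicAlgCl p) (q : ℚ_[p])‖ = ‖(q : ℚ_[p])‖ :=
      PadicAlgCl.norm_extends p q
    exact (congrArg (fun z : PadicAlgCl p => ‖z‖)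
      ((IsAlgClosed.lift (R := ℚ) (S := Qbar) (M := PadicAlgCl p)).commutes q)).trans
      (by simpa using h)⟩

/-- The image of the Haar probability measure of the absolute Galois group under the orbit map
`σ ↦ σ w`, where `‖α‖_{σ w} = ‖σ⁻¹ α‖_w`. -/
def orbitMeasure (w : Place Qbar) : Measure PlaceSpace :=
  letI : MeasurableSpace GalQ := borel GalQ
  haveI : BorelSpace GalQ := ⟨rfl⟩
  (Measure.haarMeasure (⊤ : TopologicalSpace.PositiveCompacts GalQ)).map
    fun σ => PlaceSpace.ofPlace (w.comap (σ⁻¹ : GalQ).toAlgHom)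

/-- The Allcock-Vaaler measure `λ`, i.e. the Galois-invariant Borel measure on the space of places
which gives mass one to the set of places over each place of `ℚ`. Since the embeddings of `K` into
an algebraic closure of `ℚ_v` are equidistributed under Haar measure, and `[K_v : ℚ_v]` of them
induce the place `v` of `K`, it is the Borel measure with `λ (Y(K, v)) = [K_v : ℚ_v] / [K : ℚ]`. -/
def avMeasure : Measure PlaceSpace :=
  orbitMeasure complexPlace +
    Measure.sum fun p : Nat.Primes =>
      haveI : Fact (p : ℕ).Prime := ⟨p.2⟩
      orbitMeasure (padicPlace p)

/-- The classes in `L^p` of the functions belonging to a set of functions. -/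
def lpClasses (p : ℝ≥0∞) (V : Set (PlaceSpace → ℝ)) : Set (Lp ℝ p avMeasure) :=
  {g | ∃ f ∈ V, g =ᵐ[avMeasure] f}

/-- The elements of `C₀(Y)` belonging to a set of functions. -/
def c0Functions (V : Set (PlaceSpace → ℝ)) : Set C₀(PlaceSpace, ℝ) := {g | ⇑g ∈ V}

/-- The completion `F_p` of `F` for the `L^p` norm (`1 ≤ p < ∞`), as the closure of `F` in the
Banach space `L^p(Y, λ)`. -/
def weilSpace (p : ℝ≥0∞) [Fact (1 ≤ p)] : Set (Lp ℝ p avMeasure) :=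
  closure (lpClasses p (algFun : Set (PlaceSpace → ℝ)))

/-- The completion `F_∞` of `F` for the supremum norm, as the closure of `F` in the Banach
space `C₀(Y)`. -/
def weilSpaceTop : Set C₀(PlaceSpace, ℝ) :=
  closure (c0Functions (algFun : Set (PlaceSpace → ℝ)))

/-- All elements of `L^p(Y, λ)` with support in the closed set `S` and with integral zero
on `S`. -/
def lpHyperplane (p : ℝ≥0∞) (S : Set PlaceSpace) : Set (Lp ℝ p avMeasure) :=
  {f | (∀ᵐ y ∂avMeasure, y ∉ S → f y = 0) ∧ ∫ y in S, f y ∂avMeasure = 0}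

/-- All elements of `C₀(Y)` with support in `S` and with integral zero on `S`. -/
def c0Hyperplane (S : Set PlaceSpace) : Set C₀(PlaceSpace, ℝ) :=
  {f | tsupport f ⊆ S ∧ ∫ y in S, f y ∂avMeasure = 0}

end

/-!
The proof approximates functions on `S` by functions factoring through the places of a single number
field, and treats those by the unit theorem and the finiteness of the class group.

*Product formula.* For a number `α` whose function has compact support, `∫ f_α dλ = 0`
(`integral_logNorm_eq_zero`). Averaging `log ‖σ⁻¹ α‖` over Haar measure and, by invariance of that
measure, over lifts of a finite Galois group replaces `α` by its norm to `ℚ`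
(`exists_norm_integral_orbitMeasure`), and the product formula over `ℚ` applies. Hence `S`-units lie
in the hyperplane of functions with integral zero, which is closed.

*Units.* Let `L` be a number field. A nonarchimedean place `v` of `L` is determined by its prime
ideal, and a generator of a principal power of that ideal is a unit at all other nonarchimedean
places (`Place.exists_integer_apply_lt_one`). An archimedean place is induced by a complex
embedding, by the Gelfand-Mazur theorem. Therefore a function on finitely many places of `L` is a real
combination of logarithms of such generators, plus a function of the infinite places. By Dirichlet's
unit theorem, the logarithms of units have codimension at most one among the latter, and constants
provide a complement because their integral is not zero. So every locally constant function with
support in `S` is a real combination of `S`-units plus a multiple of the indicator function of the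
archimedean places (`level_mem_extendedSpan`).

*Density.* Continuous functions with support in `S` are uniform limits of locally constant ones. If
the integral vanishes, the archimedean coefficient is small and may be dropped. Real coefficients
cause no harm since `ℚ` is dense in `ℝ`. This gives density for the supremum norm
(`c0Hyperplane_subset_closure`). For `p < ∞` it gives density in `L^p`, as continuous functions are
dense there and the projection to the functions with integral zero is continuous
(`lpHyperplane_subset_closure`).
-/

/-! ### Topology of the space of places -/

noncomputable section

instance {F : Type} [Field F] [Algebra ℚ F] : DiscreteTopology (Place F) := ⟨rfl⟩

namespace PlaceSpace

lemma continuous_eval (K : NumField) : Continuous fun y : PlaceSpace => y.1 K :=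
  (continuous_apply K).comp continuous_subtype_val

lemma isClopen_above (K : NumField) (v : Place K.1) : IsClopen (above K v) :=
  (isClopen_discrete {v}).preimage (continuous_eval K)

lemma eval_eq_of_le {K L : NumField} (h : K.1 ≤ L.1) {y z : PlaceSpace} (hyz : y.1 L = z.1 L) :
    y.1 K = z.1 K := by
  rw [← y.2 K L h, ← z.2 K L h, hyz]

lemma exists_le_of_finset (s : Finset NumField) : ∃ L : NumField, ∀ K ∈ s, K.1 ≤ L.1 := by
  classical
  induction s using Finset.induction_on with
  | empty => exact ⟨rationals, by simp⟩
  | insert K s _ ih =>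
    obtain ⟨L, hL⟩ := ih
    have := K.2
    have := L.2
    refine ⟨⟨K.1 ⊔ L.1, inferInstance⟩, fun M hM => ?_⟩
    rcases Finset.mem_insert.1 hM with rfl | hM
    · exact le_sup_left
    · exact (hL M hM).trans le_sup_right

/-- The sets `Y(K, v)` form a basis of the topology: finitely many conditions at number fields
amount to a single condition at their compositum. -/
lemma exists_above_subset {U : Set PlaceSpace} (hU : IsOpen U) {y : PlaceSpace} (hy : y ∈ U) :
    ∃ K : NumField, above K (y.1 K) ⊆ U := by
  obtain ⟨V, hV, rfl⟩ := isOpen_induced_iff.1 hU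
  obtain ⟨I, u, hu, hsub⟩ := isOpen_pi_iff.1 hV y.1 hy
  obtain ⟨L, hL⟩ := exists_le_of_finset I
  refine ⟨L, fun z hz => hsub fun K hK => ?_⟩
  have : z.1 K = y.1 K := eval_eq_of_le (hL K hK) hz
  rw [this]
  exact (hu K hK).2

instance : T2Space PlaceSpace :=
  inferInstanceAs (T2Space {y : ∀ K : NumField, Place K.1 //
    ∀ (K L : NumField) (h : K.1 ≤ L.1), (y L).comap (IntermediateField.inclusion h) = y K})

instance : Countable Qbar :=
  Set.countable_univ_iff.1 ((Algebraic.countable ℚ Qbar).mono fun x _ =>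
    Algebra.IsAlgebraic.isAlgebraic x)

instance : Countable NumField := by
  have hsurj : Function.Surjective (fun s : Finset Qbar =>
      (⟨IntermediateField.adjoin ℚ (s : Set Qbar),
        IntermediateField.finiteDimensional_adjoin
          fun x _ => Algebra.IsIntegral.isIntegral x⟩ : NumField)) := by
    intro K
    have := K.2
    obtain ⟨s, hs⟩ := IntermediateField.fg_def.1 
      (IntermediateField.essFiniteType_iff.1 (inferInstance : Algebra.EssFiniteType ℚ K.1))
    exact ⟨hs.1.toFinset, Subtype.ext (by simpa using hs.2)⟩
  exact hsurj.countable

instance : TopologicalSpace.PseudoMetrizableSpace PlaceSpace :=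
  haveI : TopologicalSpace.IsCompletelyMetrizableSpace (∀ K : NumField, Place K.1) :=
    .pi_countable
  Topology.IsInducing.subtypeVal.pseudoMetrizableSpace

/-- Two Galois elements which agree on `K` carry a place to places which agree on `K`. -/
lemma continuous_ofPlace_comap (w : Place Qbar) :
    Continuous fun σ : GalQ => ofPlace (w.comap (σ⁻¹ : GalQ).toAlgHom) := by
  refine Continuous.subtype_mk (continuous_pi fun K => ?_) _
  refine IsLocallyConstant.continuous ?_
  rw [IsLocallyConstant.iff_exists_open]
  intro σ
  have := K.2
  refine ⟨(fun τ => σ * τ⁻¹) ⁻¹' (K.1.fixingSubgroup : Set GalQ), ?_, ?_, fun τ hτ => ?_⟩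
  · exact (IntermediateField.fixingSubgroup_isOpen K.1).preimage
      (continuous_const.mul continuous_inv)
  · simp
  · refine Subtype.ext (AbsoluteValue.ext fun x => ?_)
    have h := (IntermediateField.mem_fixingSubgroup_iff _ _).1 hτ x x.2
    have h2 : τ⁻¹ (x : Qbar) = σ⁻¹ (x : Qbar) := by
      exact (AlgEquiv.eq_symm_apply σ).2 h
    exact congrArg w.1 h2

end PlaceSpace

lemma logNorm_eq (K : NumField) {α : Qbarˣ} (hα : (α : Qbar) ∈ K.1) (y : PlaceSpace) :
    logNorm α y = Real.log ((y.1 K).1 ⟨α, hα⟩) :=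
  congrArg Real.log (y.norm_eq K ⟨α, hα⟩)

lemma continuous_logNorm (α : Qbarˣ) : Continuous (logNorm α) :=
  (continuous_of_discreteTopology (f := fun v : Place (generatedBy (α : Qbar)).1 =>
    Real.log (v.1 ⟨α, IntermediateField.mem_adjoin_simple_self ℚ _⟩))).comp
    (PlaceSpace.continuous_eval (generatedBy (α : Qbar)))

/-! ### The Allcock-Vaaler measure and the product formula -/

instance : MeasurableSpace GalQ := borel GalQ

instance : BorelSpace GalQ := ⟨rfl⟩

/-- The Haar probability measure of the absolute Galois group. -/
abbrev galHaar : Measure GalQ :=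
  Measure.haarMeasure (⊤ : TopologicalSpace.PositiveCompacts GalQ)

instance : IsProbabilityMeasure galHaar := ⟨by
  simpa using Measure.haarMeasure_self (K₀ := (⊤ : TopologicalSpace.PositiveCompacts GalQ))⟩

lemma orbitMeasure_eq (w : Place Qbar) :
    orbitMeasure w =
      galHaar.map fun σ => PlaceSpace.ofPlace (w.comap (σ⁻¹ : GalQ).toAlgHom) := rfl

instance (w : Place Qbar) : IsProbabilityMeasure (orbitMeasure w) :=
  Measure.isProbabilityMeasure_map (PlaceSpace.continuous_ofPlace_comap w).aemeasurable

lemma ae_orbitMeasure_eval_rationals (w : Place Qbar) :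
    ∀ᵐ y ∂orbitMeasure w, y.1 rationals = w.comap rationals.1.val := by
  rw [orbitMeasure_eq]
  refine (ae_map_iff (PlaceSpace.continuous_ofPlace_comap w).aemeasurable
    (PlaceSpace.isClopen_above rationals (w.comap rationals.1.val)).isOpen.measurableSet).2 ?_
  refine Filter.Eventually.of_forall fun σ => Subtype.ext (AbsoluteValue.ext fun x => ?_)
  obtain ⟨q, hq⟩ := IntermediateField.mem_bot.1 x.2
  change w.1 ((σ⁻¹ : GalQ) (x : Qbar)) = w.1 (x : Qbar)
  rw [← hq, AlgEquiv.commutes]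

lemma continuous_log_galois (w : Place Qbar) (α : Qbarˣ) :
    Continuous fun σ : GalQ => Real.log (w.1 ((σ⁻¹ : GalQ) (α : Qbar))) :=
  (continuous_logNorm α).comp (PlaceSpace.continuous_ofPlace_comap w)

lemma integral_orbitMeasure_logNorm (w : Place Qbar) (α : Qbarˣ) :
    ∫ y, logNorm α y ∂orbitMeasure w =
      ∫ σ : GalQ, Real.log (w.1 ((σ⁻¹ : GalQ) (α : Qbar))) ∂galHaar := by
  rw [orbitMeasure_eq, integral_map (PlaceSpace.continuous_ofPlace_comap w).aemeasurable
    (continuous_logNorm α).aestronglyMeasurable]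
  rfl

/-- The average of `f_α` over the places above a place `v` of `ℚ` is `log ‖N‖_v / d`, where `N` is
the norm of `α` from a Galois extension of degree `d`. -/
lemma exists_norm_integral_orbitMeasure (α : Qbarˣ) :
    ∃ (d : ℕ) (N : ℚ), d ≠ 0 ∧ N ≠ 0 ∧ ∀ w : Place Qbar,
      d * ∫ y, logNorm α y ∂orbitMeasure w = Real.log (w.1 (algebraMap ℚ Qbar N)) := by
  have := (generatedBy (α : Qbar)).2
  let K : IntermediateField ℚ Qbar :=
    IntermediateField.normalClosure ℚ (generatedBy (α : Qbar)).1 Qbar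
  have hα : (α : Qbar) ∈ K :=
    (IntermediateField.le_normalClosure (generatedBy (α : Qbar)).1)
      (IntermediateField.mem_adjoin_simple_self ℚ (α : Qbar))
  have : FiniteDimensional ℚ K := inferInstance
  have : Normal ℚ K := normalClosure.normal ℚ _ Qbar
  have : IsGalois ℚ K := ⟨⟩
  let a : K := ⟨α, hα⟩
  have ha : a ≠ 0 := fun h => α.ne_zero (congrArg Subtype.val h)
  choose lift hlift using AlgEquiv.restrictNormalHom_surjective (F := ℚ) (K₁ := K) Qbar
  have hprod : ∏ τ : Gal(K/ℚ), lift τ (α : Qbar) = algebraMap ℚ Qbar (Algebra.norm ℚ a) := by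
    have h := congrArg (algebraMap K Qbar) (Algebra.norm_eq_prod_automorphisms ℚ a)
    rw [← IsScalarTower.algebraMap_apply, map_prod] at h
    rw [h]
    refine Finset.prod_congr rfl fun τ _ => ?_
    conv_rhs => rw [← hlift τ]
    exact (AlgEquiv.restrictNormal_commutes (lift τ) K a).symm
  refine ⟨Fintype.card Gal(K/ℚ), Algebra.norm ℚ a, Fintype.card_ne_zero,
    Algebra.norm_ne_zero_iff.2 ha, fun w => ?_⟩
  have hne : ∀ (σ τ : GalQ), w.1 (σ (τ (α : Qbar))) ≠ 0 := fun σ τ => by simp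
  -- The Haar measure is invariant under translation by a lift of `τ`.
  have htrans : ∀ τ : Gal(K/ℚ), ∫ σ : GalQ, Real.log (w.1 ((σ⁻¹ : GalQ) (lift τ α))) ∂galHaar
      = ∫ y, logNorm α y ∂orbitMeasure w := by
    intro τ
    rw [integral_orbitMeasure_logNorm, ← integral_mul_left_eq_self (μ := galHaar)
      (fun σ : GalQ => Real.log (w.1 ((σ⁻¹ : GalQ) (α : Qbar)))) (lift τ)⁻¹]
    simp only [mul_inv_rev, inv_inv, AlgEquiv.mul_apply]
  calc (Fintype.card Gal(K/ℚ) : ℝ) * ∫ y, logNorm α y ∂orbitMeasure w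
      = ∑ τ : Gal(K/ℚ), ∫ σ : GalQ, Real.log (w.1 ((σ⁻¹ : GalQ) (lift τ α))) ∂galHaar := by
        simp only [htrans, Finset.sum_const, Finset.card_univ, nsmul_eq_mul]
    _ = ∫ σ : GalQ, ∑ τ : Gal(K/ℚ), Real.log (w.1 ((σ⁻¹ : GalQ) (lift τ α))) ∂galHaar := by
        refine (integral_finsetSum _ fun τ _ => ?_).symm
        refine Continuous.integrable_of_hasCompactSupport ?_ (HasCompactSupport.of_compactSpace _)
        exact continuous_log_galois w (Units.map (lift τ : Qbar →* Qbar) α)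
    _ = ∫ σ : GalQ, Real.log (w.1 (algebraMap ℚ Qbar (Algebra.norm ℚ a))) ∂galHaar := by
        congr 1
        funext σ
        rw [← Real.log_prod fun τ _ => hne _ _, ← map_prod, ← map_prod, hprod, AlgEquiv.commutes]
    _ = _ := by simp

open Rat.AbsoluteValue in
/-- The product formula over `ℚ`. -/
lemma hasSum_log_padic {q : ℚ} (hq : q ≠ 0) :
    HasSum (fun p : Nat.Primes => haveI : Fact (p : ℕ).Prime := ⟨p.2⟩
      Real.log (padic p q)) (-Real.log (real q)) := by
  let P : ℚ → Prop := fun a => HasSum (fun p : Nat.Primes =>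
    haveI : Fact (p : ℕ).Prime := ⟨p.2⟩; Real.log (padic p a)) (-Real.log (real a))
  have hmul : ∀ a b : ℚ, a ≠ 0 → b ≠ 0 → P a → P b → P (a * b) := by
    intro a b ha hb h1 h2
    have h := HasSum.add h1 h2
    rw [← neg_add, ← Real.log_mul ((map_ne_zero real).2 ha) ((map_ne_zero real).2 hb),
      ← map_mul] at h
    refine h.congr_fun fun p => ?_
    have : Fact (p : ℕ).Prime := ⟨p.2⟩
    rw [map_mul, Real.log_mul ((map_ne_zero _).2 ha) ((map_ne_zero _).2 hb)]
  have hinv : ∀ a : ℚ, P a → P a⁻¹ := by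
    intro a h1
    have h := HasSum.neg h1
    rw [← Real.log_inv, ← map_inv₀] at h
    refine h.congr_fun fun p => ?_
    rw [map_inv₀, Real.log_inv]
  have hnat : ∀ n : ℕ, n ≠ 0 → P n := by
    intro n
    induction n using Nat.recOnMul with
    | zero => exact fun h => (h rfl).elim
    | one => simp [P, hasSum_zero]
    | prime l hl =>
      intro _
      have : Fact l.Prime := ⟨hl⟩
      have h := hasSum_single (f := fun p : Nat.Primes => haveI : Fact (p : ℕ).Prime := ⟨p.2⟩
        Real.log (padic p (l : ℚ))) ⟨l, hl⟩ (fun p hp => ?_)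
      · convert h using 1
        simp [padic_eq_padicNorm, real_eq_abs]
      · have : Fact (p : ℕ).Prime := ⟨p.2⟩
        have : (p : ℕ) ≠ l := fun h => hp (Subtype.ext h)
        simp [padic_eq_padicNorm, padicNorm.padicNorm_of_prime_of_ne this]
    | mul a b ha hb =>
      intro h
      rw [Nat.cast_mul]
      obtain ⟨h1, h2⟩ := mul_ne_zero_iff.1 h
      exact hmul _ _ (by exact_mod_cast h1) (by exact_mod_cast h2) (ha h1) (hb h2)
  have hnum : P q.num := by
    have h := hnat q.num.natAbs (by simpa using hq)
    rw [← Int.cast_natCast] at h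
    rcases Int.natAbs_eq q.num with h1 | h1 <;> rw [h1]
    · exact h
    · simpa [P] using h
  have hden := hinv _ (hnat q.den q.den_nz)
  have h := hmul _ _ (by simpa using hq) (by simp) hnum hden
  rw [← div_eq_mul_inv, Rat.num_div_den] at h
  exact h

lemma complexPlace_algebraMap (q : ℚ) :
    complexPlace.1 (algebraMap ℚ Qbar q) = Rat.AbsoluteValue.real q :=
  (congrArg (fun z : ℂ => ‖z‖)
    ((IsAlgClosed.lift (R := ℚ) (S := Qbar) (M := ℂ)).commutes q)).trans (by simp)

lemma padicPlace_algebraMap (p : ℕ) [Fact p.Prime] (q : ℚ) :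
    (padicPlace p).1 (algebraMap ℚ Qbar q) = Rat.AbsoluteValue.padic p q := by
  have h : ‖algebraMap ℚ_[p] (PadicAlgCl p) (q : ℚ_[p])‖ = ‖(q : ℚ_[p])‖ :=
    PadicAlgCl.norm_extends p q
  exact (congrArg (fun z : PadicAlgCl p => ‖z‖)
    ((IsAlgClosed.lift (R := ℚ) (S := Qbar) (M := PadicAlgCl p)).commutes q)).trans
    (by simpa using h)

/-- Distinct primes give distinct places of `ℚ`. -/
lemma padicPlace_comap_injective : Function.Injective fun p : Nat.Primes =>
    have : Fact (p : ℕ).Prime := ⟨p.2⟩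
    (padicPlace p).comap rationals.1.val := by
  intro p l hpl
  have : Fact (p : ℕ).Prime := ⟨p.2⟩
  have : Fact (l : ℕ).Prime := ⟨l.2⟩
  by_contra hne
  have h1 : (padicPlace p).1 (algebraMap ℚ Qbar (p : ℚ))
      = (padicPlace l).1 (algebraMap ℚ Qbar (p : ℚ)) :=
    congrArg (fun v : Place rationals.1 => v.1 (algebraMap ℚ rationals.1 (p : ℚ))) hpl
  rw [padicPlace_algebraMap, padicPlace_algebraMap] at h1
  have h2 : (l : ℕ) ≠ p := fun h => hne (Subtype.ext h.symm)
  rw [Rat.AbsoluteValue.padic_eq_padicNorm, Rat.AbsoluteValue.padic_eq_padicNorm,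
    padicNorm.padicNorm_p_of_prime, padicNorm.padicNorm_of_prime_of_ne h2] at h1
  have h3 := p.2.one_lt
  have h4 : ((p : ℕ) : ℝ) = 1 := by simpa using h1
  have h5 : (p : ℕ) = 1 := by exact_mod_cast h4
  omega

lemma avMeasure_lt_top_of_isCompact {S : Set PlaceSpace} (hS : IsCompact S) :
    avMeasure S < ∞ := by
  have hfin : ((fun y : PlaceSpace => y.1 rationals) '' S).Finite :=
    (hS.image (PlaceSpace.continuous_eval rationals)).finite_of_discrete
  rw [avMeasure, Measure.add_apply, Measure.sum_apply _ hS.measurableSet]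
  refine ENNReal.add_lt_top.2 ⟨measure_lt_top _ _, ?_⟩
  have hP := hfin.preimage (padicPlace_comap_injective.injOn)
  rw [tsum_eq_sum (s := hP.toFinset)]
  · exact ENNReal.sum_lt_top.2 fun p _ => measure_lt_top _ _
  · intro p hp
    have : Fact (p : ℕ).Prime := ⟨p.2⟩
    refine measure_mono_null ?_ (ae_orbitMeasure_eval_rationals (padicPlace p))
    intro y hy hy'
    exact hp (hP.mem_toFinset.2 ⟨y, hy, hy'⟩)

instance : IsFiniteMeasureOnCompacts avMeasure := ⟨fun _ hS => avMeasure_lt_top_of_isCompact hS⟩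

lemma PlaceSpace.isClopen_archimedean : IsClopen PlaceSpace.archimedean :=
  (isClopen_discrete {v : Place rationals.1 | v.IsArchimedean}).preimage
    (PlaceSpace.continuous_eval rationals)

lemma one_le_avMeasure_archimedean : 1 ≤ avMeasure PlaceSpace.archimedean := by
  have h : orbitMeasure complexPlace PlaceSpace.archimedean = 1 := by
    rw [prob_compl_eq_zero_iff PlaceSpace.isClopen_archimedean.isOpen.measurableSet |>.symm]
    refine measure_mono_null ?_ (ae_orbitMeasure_eval_rationals complexPlace)
    intro y hy hy'
    refine hy fun q => ?_
    have hy'' : y.1 rationals = complexPlace.comap rationals.1.val := hy'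
    rw [hy'']
    exact complexPlace_algebraMap q
  rw [avMeasure, Measure.add_apply, h]
  exact le_self_add

lemma integrable_of_continuous_of_support_subset {S : Set PlaceSpace} (hS : IsCompact S)
    {f : PlaceSpace → ℝ} (hf : Continuous f) (hfS : Function.support f ⊆ S) :
    Integrable f avMeasure :=
  (integrableOn_iff_integrable_of_support_subset hfS).1 (hf.continuousOn.integrableOn_compact hS)

/-- The product formula, for algebraic numbers whose associated function has compact support. -/
lemma integral_logNorm_eq_zero {S : Set PlaceSpace} (hS : IsCompact S) (α : Qbarˣ)
    (hα : Function.support (logNorm α) ⊆ S) : ∫ y, logNorm α y ∂avMeasure = 0 := by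
  have hint := integrable_of_continuous_of_support_subset hS (continuous_logNorm α) hα
  obtain ⟨d, N, hd, hN, h⟩ := exists_norm_integral_orbitMeasure α
  have hd' : (d : ℝ) ≠ 0 := by exact_mod_cast hd
  rw [avMeasure, integrable_add_measure] at hint
  rw [avMeasure, integral_add_measure hint.1 hint.2]
  have h1 := (hasSum_integral_measure hint.2).mul_left (d : ℝ)
  have h2 := hasSum_log_padic hN
  simp only [h, padicPlace_algebraMap] at h1
  have h3 := h1.unique h2
  have h4 := h complexPlace
  rw [complexPlace_algebraMap] at h4
  refine (mul_eq_zero.1 ?_).resolve_left hd'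
  rw [mul_add, h3, h4]
  ring

/-! ### Places of a number field -/

lemma le_of_forall_pow_le_mul_pow {a b C : ℝ} (hb : 0 ≤ b) (h : ∀ n : ℕ, a ^ n ≤ C * b ^ n) :
    a ≤ b := by
  by_contra! hab
  rcases hb.eq_or_lt with rfl | hb
  · have := h 1
    simp at this
    linarith
  · obtain ⟨n, hn⟩ := pow_unbounded_of_one_lt C ((one_lt_div hb).2 hab)
    rw [div_pow, lt_div_iff₀ (pow_pos hb n)] at hn
    exact absurd (h n) (not_le.2 hn)

/-- An algebra homomorphism from a finite-dimensional normed field over `ℝ` to `ℂ` preserves the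
norm, as the two norms are equivalent and multiplicative. -/
lemma norm_algHom_complex {C : Type*} [NormedField C] [NormedAlgebra ℝ C] [FiniteDimensional ℝ C]
    (ψ : C →ₐ[ℝ] ℂ) (x : C) : ‖ψ x‖ = ‖x‖ := by
  apply le_antisymm
  · let f := LinearMap.toContinuousLinearMap ψ.toLinearMap
    refine le_of_forall_pow_le_mul_pow (C := ‖f‖) (norm_nonneg _) fun n => ?_
    rw [← norm_pow, ← norm_pow, ← map_pow]
    exact f.le_opNorm (x ^ n)
  · obtain ⟨K, -, hK⟩ := ψ.toLinearMap.exists_antilipschitzWith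
      (LinearMap.ker_eq_bot.2 ψ.toRingHom.injective)
    refine le_of_forall_pow_le_mul_pow (C := K) (norm_nonneg _) fun n => ?_
    rw [← norm_pow, ← norm_pow, ← map_pow]
    simpa using hK.le_mul_dist (x ^ n) 0

/-- Ostrowski: an absolute value extending the real absolute value of `ℚ` comes from a complex
embedding. The completion is a normed field over `ℝ`, so it is `ℝ` or `ℂ` by the Gelfand-Mazur
theorem. -/
lemma exists_ringHom_complex_of_extends_real {F : Type} [Field F] [Algebra ℚ F]
    (v : AbsoluteValue F ℝ) (h : ∀ q : ℚ, v (algebraMap ℚ F q) = Rat.AbsoluteValue.real q) :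
    ∃ σ : F →+* ℂ, ∀ x, v x = ‖σ x‖ := by
  let ι : F →+* v.Completion :=
    (UniformSpace.Completion.coeRingHom (α := WithAbs v)).comp
      (WithAbs.equiv v).symm.toRingHom
  have hι : ∀ x, ‖ι x‖ = v x := fun x =>
    (UniformSpace.Completion.norm_coe (E := WithAbs v) _).trans rfl
  let f : ℚ →+* v.Completion := ι.comp (algebraMap ℚ F)
  have hf : ∀ q, ‖f q‖ = |(q : ℝ)| := fun q => by
    rw [RingHom.comp_apply, hι, h, Rat.AbsoluteValue.real_eq_abs, Rat.cast_abs]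
  have hfi : Isometry f := AddMonoidHomClass.isometry_of_norm f fun q => by
    rw [hf, ← Real.norm_eq_abs, Rat.norm_cast_real]
  have ue : IsUniformInducing (Rat.castHom ℝ) := Rat.isUniformEmbedding_coe_real.isUniformInducing
  have dr : DenseRange (Rat.castHom ℝ) := Rat.isDenseEmbedding_coe_real.dense
  let φ : ℝ →+* v.Completion :=
    IsDenseInducing.extendRingHom ue dr hfi.uniformContinuous
  have hφc : Continuous φ :=
    (uniformContinuous_uniformly_extend ue dr hfi.uniformContinuous).continuous
  have hφ : ∀ r : ℝ, ‖φ r‖ = ‖r‖ := by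
    refine fun r => congrFun (DenseRange.equalizer (g := fun r => ‖φ r‖) (h := fun r => ‖r‖)
      dr hφc.norm continuous_norm (funext fun q => ?_)) r
    have h1 : φ (q : ℝ) = f q := by rw [map_ratCast φ, eq_ratCast f]
    simp only [Function.comp_apply, Rat.coe_castHom]
    rw [h1, hf, Real.norm_eq_abs]
  let _ : NormedAlgebra ℝ v.Completion :=
    { φ.toAlgebra with
      norm_smul_le := fun r x => by
        change ‖φ r * x‖ ≤ _
        rw [norm_mul, hφ] }
  obtain ⟨ψ, hψ⟩ : ∃ ψ : v.Completion →ₐ[ℝ] ℂ, FiniteDimensional ℝ v.Completion := by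
    rcases NormedAlgebra.Real.nonempty_algEquiv_or v.Completion with ⟨⟨e⟩⟩ | ⟨⟨e⟩⟩
    · exact ⟨(Algebra.ofId ℝ ℂ).comp e.toAlgHom, e.symm.toLinearEquiv.finiteDimensional⟩
    · exact ⟨e.toAlgHom, e.symm.toLinearEquiv.finiteDimensional⟩
  exact ⟨ψ.toRingHom.comp ι, fun x => by
    rw [← hι]
    exact (norm_algHom_complex ψ (ι x)).symm⟩

section Finite

open NumberField

/-- Every nonzero ideal has a principal power, the class group being finite. -/
lemma NumberField.exists_ideal_pow_eq_span {F : Type} [Field F] [NumberField F]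
    {I : Ideal (𝓞 F)} (hI : I ≠ ⊥) :
    ∃ π : 𝓞 F, I ^ Fintype.card (ClassGroup (𝓞 F)) = Ideal.span {π} := by
  have h1 : ClassGroup.mk0 ⟨I, mem_nonZeroDivisors_of_ne_zero hI⟩ ^
      Fintype.card (ClassGroup (𝓞 F)) = 1 := pow_card_eq_one
  rw [← map_pow, ClassGroup.mk0_eq_one_iff] at h1
  obtain ⟨π, hπ⟩ := h1.principal
  exact ⟨π, by simpa using hπ⟩

namespace AbsoluteValue

/-- The powers of an integer `x` are integral combinations of finitely many of them, so they are
bounded for a nonarchimedean absolute value. -/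
lemma apply_integer_le_one {F : Type} [Field F] {v : AbsoluteValue F ℝ} (hv : IsNonarchimedean v)
    (x : 𝓞 F) : v (x : F) ≤ 1 := by
  let f := minpoly ℤ x
  have hf : f.Monic := minpoly.monic (RingOfIntegers.isIntegral x)
  refine le_of_forall_pow_le_mul_pow
    (C := ∑ i ∈ Finset.range f.natDegree, v (x : F) ^ i) zero_le_one fun n => ?_
  have hf1 : f ≠ 1 := minpoly.ne_one ℤ x
  have hx : Polynomial.aeval (x : F) f = 0 := by
    have := congrArg (algebraMap (𝓞 F) F) (minpoly.aeval ℤ x)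
    rwa [← Polynomial.aeval_algebraMap_apply, map_zero] at this
  have h1 : (x : F) ^ n = Polynomial.aeval (x : F) (Polynomial.X ^ n %ₘ f) := by
    rw [Polynomial.modByMonic_eq_sub_mul_div, map_sub, map_mul, hx]
    simp
  rw [← map_pow, h1, one_pow, mul_one, Polynomial.aeval_eq_sum_range'
    (n := f.natDegree) (Polynomial.natDegree_modByMonic_lt _ hf hf1)]
  refine (v.sum_le _ _).trans (Finset.sum_le_sum fun i _ => ?_)
  rw [zsmul_eq_mul, map_mul, map_pow]
  refine mul_le_of_le_one_left (pow_nonneg (v.nonneg _) _) ?_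
  obtain ⟨m, hm | hm⟩ := Int.eq_nat_or_neg ((Polynomial.X ^ n %ₘ f).coeff i) <;>
    simpa [hm] using hv.apply_natCast_le_one

lemma apply_integer_mul {F : Type} [Field F] (v : AbsoluteValue F ℝ) (x y : 𝓞 F) :
    v ((x * y : 𝓞 F) : F) = v (x : F) * v (y : F) := v.map_mul _ _

lemma apply_integer_pow {F : Type} [Field F] (v : AbsoluteValue F ℝ) (x : 𝓞 F) (n : ℕ) :
    v ((x ^ n : 𝓞 F) : F) = v (x : F) ^ n := map_pow v (x : F) n

lemma apply_unit_eq_one {F : Type} [Field F] {v : AbsoluteValue F ℝ} (hv : IsNonarchimedean v)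
    (u : (𝓞 F)ˣ) : v ((u : 𝓞 F) : F) = 1 := by
  refine le_antisymm (apply_integer_le_one hv _) ?_
  have h1 := apply_integer_mul v (u : 𝓞 F) (u⁻¹ : (𝓞 F)ˣ)
  rw [Units.mul_inv] at h1
  have h2 := apply_integer_le_one hv ((u⁻¹ : (𝓞 F)ˣ) : 𝓞 F)
  have h3 : v ((1 : 𝓞 F) : F) = 1 := v.map_one
  rw [h3] at h1
  rw [h1]
  exact mul_le_of_le_one_right (v.nonneg _) h2

/-- The prime ideal of the ring of integers defined by a nonarchimedean absolute value. -/
def primeIdeal {F : Type} [Field F] {v : AbsoluteValue F ℝ} (hv : IsNonarchimedean v) :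
    Ideal (𝓞 F) where
  carrier := {x | v (x : F) < 1}
  zero_mem' := by simp
  add_mem' {a b} ha hb := by
    have := hv (a : F) (b : F)
    exact lt_of_le_of_lt (by simpa using this) (max_lt ha hb)
  smul_mem' c x hx := by
    refine (v.apply_integer_mul c x).trans_lt ?_
    exact mul_lt_one_of_nonneg_of_lt_one_right (apply_integer_le_one hv c) (v.nonneg _) hx

variable {F : Type} [Field F] {v w : AbsoluteValue F ℝ}

lemma mem_primeIdeal (hv : IsNonarchimedean v) {x : 𝓞 F} : x ∈ primeIdeal hv ↔ v (x : F) < 1 :=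
  Iff.rfl

lemma apply_eq_one_of_notMem (hv : IsNonarchimedean v) {x : 𝓞 F} (hx : x ∉ primeIdeal hv) :
    v (x : F) = 1 :=
  le_antisymm (apply_integer_le_one hv x) (not_lt.1 hx)

lemma isPrime_primeIdeal (hv : IsNonarchimedean v) : (primeIdeal hv).IsPrime := by
  refine Ideal.isPrime_iff.2 ⟨(Ideal.ne_top_iff_one _).2 fun h => ?_, fun {x y} hxy => ?_⟩
  · simp [mem_primeIdeal] at h
  · by_contra! h
    rw [mem_primeIdeal, apply_integer_mul, apply_eq_one_of_notMem hv h.1,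
      apply_eq_one_of_notMem hv h.2] at hxy
    simp at hxy

/-- If `π` generates `P ^ h`, with `h` the class number, and `P ^ n` is the exact power of `P` which
divides `a`, then `a ^ h` is `π ^ n` times an integer outside `P`. So the value at `a` of an absolute
value with prime ideal `P` is determined by its value at `π`. -/
lemma exists_pow_eq_of_primeIdeal_pow_eq_span [NumberField F] {P : Ideal (𝓞 F)} [P.IsPrime]
    (hP : P ≠ ⊥) {π : 𝓞 F} (hπ : P ^ Fintype.card (ClassGroup (𝓞 F)) = Ideal.span {π})
    {a : 𝓞 F} (ha : a ≠ 0) :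
    ∃ n : ℕ, ∀ (v : AbsoluteValue F ℝ) (hv : IsNonarchimedean v), primeIdeal hv = P →
      v (a : F) ^ Fintype.card (ClassGroup (𝓞 F)) = v (π : F) ^ n := by
  have hprime : Prime P := Ideal.prime_of_isPrime hP inferInstance
  have hspan : Ideal.span {a} ≠ ⊥ := by simpa using ha
  obtain ⟨J, hJ, hPJ⟩ :=
    (FiniteMultiplicity.of_prime_left hprime hspan).exists_eq_pow_mul_and_not_dvd
  set n := multiplicity P (Ideal.span {a})
  set h := Fintype.card (ClassGroup (𝓞 F))
  have hJ0 : J ≠ ⊥ := by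
    rintro rfl
    exact hPJ (dvd_zero _)
  obtain ⟨j, hj⟩ := exists_ideal_pow_eq_span hJ0
  have hjP : j ∉ P := by
    intro hmem
    rw [← Ideal.dvd_span_singleton, ← hj] at hmem
    exact hPJ (hprime.dvd_of_dvd_pow hmem)
  have hah : Associated (a ^ h) (π ^ n * j) := by
    rw [← Ideal.span_singleton_eq_span_singleton, ← Ideal.span_singleton_pow, hJ, mul_pow,
      ← Ideal.span_singleton_mul_span_singleton, ← Ideal.span_singleton_pow, ← hπ, ← hj,
      ← pow_mul, ← pow_mul, mul_comm n]
  obtain ⟨u, hu⟩ := hah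
  refine ⟨n, fun v hv hvP => ?_⟩
  have h1 := congrArg (fun x : 𝓞 F => v (x : F)) hu
  simp only [apply_integer_mul, apply_integer_pow, apply_unit_eq_one hv, mul_one] at h1
  rwa [apply_eq_one_of_notMem (x := j) hv (hvP ▸ hjP), mul_one] at h1

/-- Nonarchimedean absolute values of a number field with the same prime ideal are equivalent. -/
lemma isEquiv_of_primeIdeal_eq [NumberField F] (hv : IsNonarchimedean v) (hw : IsNonarchimedean w)
    (hP : primeIdeal hv ≠ ⊥) (h : primeIdeal hv = primeIdeal hw) : v.IsEquiv w := by
  have hprime := isPrime_primeIdeal hv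
  obtain ⟨π, hπ⟩ := exists_ideal_pow_eq_span hP
  have hc : Fintype.card (ClassGroup (𝓞 F)) ≠ 0 := Fintype.card_ne_zero
  have hπ0 : π ≠ 0 := by
    rintro rfl
    simp only [Ideal.span_singleton_zero] at hπ
    exact hP (pow_eq_zero_iff hc |>.1 hπ)
  have hπP : π ∈ primeIdeal hv := Ideal.pow_le_self hc (hπ ▸ Ideal.mem_span_singleton_self π)
  have key : ∀ (u : AbsoluteValue F ℝ) (hu : IsNonarchimedean u), primeIdeal hu = primeIdeal hv →
      0 < u (π : F) ∧ u (π : F) < 1 := fun u hu hueq =>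
    ⟨by simpa using hπ0, (mem_primeIdeal hu).1 (hueq ▸ hπP)⟩
  rw [isEquiv_iff_lt_one_iff]
  intro x
  rcases eq_or_ne x 0 with rfl | hx
  · simp
  obtain ⟨a, b, hb, rfl⟩ := IsFractionRing.div_surjective (A := 𝓞 F) x
  have hb0 : b ≠ 0 := nonZeroDivisors.ne_zero hb
  have ha0 : a ≠ 0 := by
    rintro rfl
    simp at hx
  obtain ⟨m, hm⟩ := exists_pow_eq_of_primeIdeal_pow_eq_span hP hπ ha0
  obtain ⟨n, hn⟩ := exists_pow_eq_of_primeIdeal_pow_eq_span hP hπ hb0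
  have key2 : ∀ (u : AbsoluteValue F ℝ) (hu : IsNonarchimedean u), primeIdeal hu = primeIdeal hv →
      (u (algebraMap (𝓞 F) F a / algebraMap (𝓞 F) F b) < 1 ↔ n < m) := by
    intro u hu hueq
    obtain ⟨k1, k2⟩ := key u hu hueq
    rw [map_div₀, ← pow_lt_one_iff_of_nonneg (div_nonneg (u.nonneg _) (u.nonneg _)) hc, div_pow,
      hm u hu hueq, hn u hu hueq, div_lt_one (pow_pos k1 n), pow_lt_pow_iff_right_of_lt_one₀ k1 k2]
  rw [key2 v hv rfl, key2 w hw h.symm]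

end AbsoluteValue

namespace Place

variable {F : Type} [Field F] [NumberField F]

lemma isNonarchimedean {v : Place F} (hv : ¬ v.IsArchimedean) : IsNonarchimedean v.1 := by
  obtain ⟨p, hp, h⟩ := v.2.resolve_left hv
  have : IsUltrametricDist (WithAbs v.1) := by
    refine IsUltrametricDist.isUltrametricDist_of_forall_norm_natCast_le_one fun n => ?_
    change v.1 (n : F) ≤ 1
    have h1 := h n
    rw [map_natCast] at h1
    rw [h1]
    exact_mod_cast Rat.AbsoluteValue.padic_le_one p n
  have h := IsUltrametricDist.isNonarchimedean_norm (R := WithAbs v.1)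
  exact fun x y => h (WithAbs.toAbs v.1 x) (WithAbs.toAbs v.1 y)

lemma exists_prime_apply_natCast {v : Place F} (hv : ¬ v.IsArchimedean) :
    ∃ p : ℕ, p.Prime ∧ v.1 (p : F) = (p : ℝ)⁻¹ ∧
      ∀ q : ℕ, q.Prime → q ≠ p → v.1 (q : F) = 1 := by
  obtain ⟨p, hp, h⟩ := v.2.resolve_left hv
  refine ⟨p, hp.out, ?_, fun q hq hqp => ?_⟩
  · have h1 := h p
    rw [map_natCast, Rat.AbsoluteValue.padic_eq_padicNorm, padicNorm.padicNorm_p_of_prime] at h1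
    rw [h1]
    simp
  · have : Fact q.Prime := ⟨hq⟩
    have h1 := h q
    rw [map_natCast, Rat.AbsoluteValue.padic_eq_padicNorm,
      padicNorm.padicNorm_of_prime_of_ne hqp.symm] at h1
    rw [h1]
    simp

lemma primeIdeal_ne_bot {v : Place F} (hv : ¬ v.IsArchimedean) :
    AbsoluteValue.primeIdeal (isNonarchimedean hv) ≠ ⊥ := by
  obtain ⟨p, hp, h, -⟩ := exists_prime_apply_natCast hv
  intro hbot
  have hmem : (p : 𝓞 F) ∈ AbsoluteValue.primeIdeal (isNonarchimedean hv) := by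
    refine (AbsoluteValue.mem_primeIdeal _).2 ?_
    have hcast : ((p : 𝓞 F) : F) = p := map_natCast _ p
    refine (congrArg v.1 hcast).trans_lt (h.trans_lt ?_)
    exact inv_lt_one_of_one_lt₀ (by exact_mod_cast hp.one_lt)
  rw [hbot, Ideal.mem_bot] at hmem
  exact hp.ne_zero (by exact_mod_cast hmem)

/-- Equivalent nonarchimedean places are equal, being normalized at their common prime number. -/
lemma eq_of_isEquiv {v w : Place F} (hv : ¬ v.IsArchimedean) (hw : ¬ w.IsArchimedean)
    (h : v.1.IsEquiv w.1) : v = w := by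
  obtain ⟨p, hp, hvp, -⟩ := exists_prime_apply_natCast hv
  obtain ⟨q, hq, hwq, hwp⟩ := exists_prime_apply_natCast hw
  have hp1 : (p : ℝ)⁻¹ < 1 := inv_lt_one_of_one_lt₀ (by exact_mod_cast hp.one_lt)
  have hp0 : (0 : ℝ) < (p : ℝ)⁻¹ := inv_pos.2 (by exact_mod_cast hp.pos)
  have hpq : p = q := by
    by_contra hne
    have h1 := (AbsoluteValue.isEquiv_iff_lt_one_iff.1 h (p : F)).1 (hvp.trans_lt hp1)
    rw [hwp p hp hne] at h1
    exact lt_irrefl _ h1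
  subst hpq
  obtain ⟨c, -, hc⟩ := AbsoluteValue.isEquiv_iff_exists_rpow_eq.1 h
  have h2 : ((p : ℝ)⁻¹) ^ c = ((p : ℝ)⁻¹) ^ (1 : ℝ) := by
    have h3 : v.1 (p : F) ^ c = w.1 (p : F) := congrFun hc p
    rwa [hvp, hwq, ← Real.rpow_one ((p : ℝ)⁻¹), ← Real.rpow_mul hp0.le, one_mul] at h3
  have hc1 : c = 1 := (Real.rpow_right_inj hp0 hp1.ne).1 h2
  subst hc1
  refine Subtype.ext (AbsoluteValue.ext fun x => ?_)
  have := congrFun hc x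
  simpa using this

/-- For a nonarchimedean place `v` there is an integer whose only nonarchimedean place of absolute
value different from `1` is `v`: a generator of a principal power of the prime ideal of `v`. -/
lemma exists_integer_apply_lt_one {v : Place F} (hv : ¬ v.IsArchimedean) :
    ∃ π : 𝓞 F, π ≠ 0 ∧ v.1 (π : F) < 1 ∧
      ∀ w : Place F, ¬ w.IsArchimedean → w ≠ v → w.1 (π : F) = 1 := by
  have hP := primeIdeal_ne_bot hv
  have hprime := AbsoluteValue.isPrime_primeIdeal (isNonarchimedean hv)
  obtain ⟨π, hπ⟩ := exists_ideal_pow_eq_span hP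
  have hc : Fintype.card (ClassGroup (𝓞 F)) ≠ 0 := Fintype.card_ne_zero
  refine ⟨π, ?_, Ideal.pow_le_self hc (hπ ▸ Ideal.mem_span_singleton_self π), fun w hw hne => ?_⟩
  · rintro rfl
    simp only [Ideal.span_singleton_zero] at hπ
    exact hP (pow_eq_zero_iff hc |>.1 hπ)
  · by_contra h1
    have hmem : π ∈ AbsoluteValue.primeIdeal (isNonarchimedean hw) := by
      by_contra h2
      exact h1 (AbsoluteValue.apply_eq_one_of_notMem _ h2)
    have hprime' := AbsoluteValue.isPrime_primeIdeal (isNonarchimedean hw)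
    rw [← Ideal.span_singleton_le_iff_mem, ← hπ] at hmem
    have hle := Ideal.IsPrime.le_of_pow_le hmem
    have heq := (hprime.isMaximal hP).eq_of_le hprime'.ne_top hle
    exact hne (eq_of_isEquiv hv hw (AbsoluteValue.isEquiv_of_primeIdeal_eq _ _ hP heq)).symm

end Place

end Finite

/-! ### Locally constant functions and units -/

section

open NumberField

instance (L : NumField) : NumberField L.1 where
  to_charZero := inferInstance
  to_finiteDimensional := L.2

/-- The real vector space spanned by the functions of the algebraic `S`-units. -/
def sUnitSpan (S : Set PlaceSpace) : Submodule ℝ (PlaceSpace → ℝ) :=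
  Submodule.span ℝ (sUnitFun S : Set (PlaceSpace → ℝ))

lemma properties_of_mem_sUnitFun {S : Set PlaceSpace} (hS : IsCompact S) {f : PlaceSpace → ℝ}
    (hf : f ∈ sUnitFun S) :
    Continuous f ∧ Function.support f ⊆ S ∧ ∫ y, f y ∂avMeasure = 0 := by
  obtain ⟨⟨α, rfl⟩, hsupp⟩ := hf
  have h := (subset_tsupport _).trans hsupp
  exact ⟨continuous_logNorm α, h, integral_logNorm_eq_zero hS α h⟩

lemma properties_of_mem_sUnitSpan {S : Set PlaceSpace} (hS : IsCompact S) {f : PlaceSpace → ℝ}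
    (hf : f ∈ sUnitSpan S) :
    Continuous f ∧ Function.support f ⊆ S ∧ ∫ y, f y ∂avMeasure = 0 := by
  induction hf using Submodule.span_induction with
  | mem f hf => exact properties_of_mem_sUnitFun hS hf
  | zero => exact ⟨continuous_const, by simp, by simp⟩
  | add f g _ _ hf hg =>
    refine ⟨hf.1.add hg.1, (Function.support_add _ _).trans (Set.union_subset hf.2.1 hg.2.1), ?_⟩
    have h1 := integrable_of_continuous_of_support_subset hS hf.1 hf.2.1
    have h2 := integrable_of_continuous_of_support_subset hS hg.1 hg.2.1
    simp only [Pi.add_apply]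
    rw [integral_add h1 h2, hf.2.2, hg.2.2, add_zero]
  | smul c f _ hf =>
    refine ⟨hf.1.const_smul c, (Function.support_const_smul_subset c f).trans hf.2.1, ?_⟩
    simp only [Pi.smul_apply]
    rw [integral_smul, hf.2.2, smul_zero]

lemma PlaceSpace.mem_archimedean_iff (y : PlaceSpace) (L : NumField) :
    y ∈ PlaceSpace.archimedean ↔ (y.1 L).IsArchimedean := by
  have h := y.2 rationals L bot_le
  have h1 : ∀ q : ℚ, (y.1 rationals).1 (algebraMap ℚ _ q) = (y.1 L).1 (algebraMap ℚ _ q) :=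
    fun q => congrArg (fun v : Place rationals.1 => v.1 (algebraMap ℚ _ q)) h.symm
  exact forall_congr' fun q => by rw [h1]

/-- The function of a nonzero integer of `L` as a function on the places of `L`. -/
lemma exists_logNorm_eq_log (L : NumField) {x : 𝓞 L.1} (hx : x ≠ 0) :
    ∃ α : Qbarˣ, ∀ y, logNorm α y = Real.log ((y.1 L).1 (x : L.1)) := by
  have hx' : ((x : L.1) : Qbar) ≠ 0 := by simpa using hx
  exact ⟨Units.mk0 _ hx', fun y => logNorm_eq L (α := Units.mk0 _ hx') (x : L.1).2 y⟩

/-- The function of an integer of `L` which is a unit at the places outside `S`. -/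
lemma log_integer_mem_sUnitFun {S : Set PlaceSpace} (hS : IsClosed S) (L : NumField) {x : 𝓞 L.1}
    (hx : x ≠ 0) (hxS : ∀ y ∉ S, (y.1 L).1 (x : L.1) = 1) :
    (fun y : PlaceSpace => Real.log ((y.1 L).1 (x : L.1))) ∈ sUnitFun S := by
  obtain ⟨α, hα⟩ := exists_logNorm_eq_log L hx
  refine ⟨⟨α, funext hα⟩, closure_minimal (fun y hy => ?_) hS⟩
  by_contra hyS
  exact hy (by simp [hxS y hyS])

namespace Place

/-- An archimedean place of a number field is given by an infinite place. -/
lemma exists_infinitePlace {F : Type} [Field F] [NumberField F] {v : Place F}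
    (hv : v.IsArchimedean) : ∃ w : InfinitePlace F, ∀ x, v.1 x = w x := by
  obtain ⟨σ, hσ⟩ := exists_ringHom_complex_of_extends_real v.1 hv
  exact ⟨InfinitePlace.mk σ, hσ⟩

lemma ext_of_infinitePlace {F : Type} [Field F] [NumberField F] {v v' : Place F}
    {w : InfinitePlace F} (h : ∀ x, v.1 x = w x) (h' : ∀ x, v'.1 x = w x) : v = v' :=
  Subtype.ext (AbsoluteValue.ext fun x => (h x).trans (h' x).symm)

end Place

open Classical in
/-- The extension by zero to the space of places of a function of the infinite places of `L`. -/
def ofInfinitePlaces (L : NumField) : (InfinitePlace L.1 → ℝ) →ₗ[ℝ] (PlaceSpace → ℝ) where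
  toFun H y := if h : (y.1 L).IsArchimedean then H (Place.exists_infinitePlace h).choose else 0
  map_add' H H' := by
    funext y
    simp only [Pi.add_apply]
    split_ifs <;> simp
  map_smul' c H := by
    funext y
    simp only [Pi.smul_apply, RingHom.id_apply]
    split_ifs <;> simp

/-- The space of real functions on the infinite places spanned by the logarithms of units. -/
def unitLogSpan (F : Type) [Field F] [NumberField F] : Submodule ℝ (InfinitePlace F → ℝ) :=
  Submodule.span ℝ (Set.range fun (u : (𝓞 F)ˣ) (w : InfinitePlace F) =>
    Real.log (w ((u : 𝓞 F) : F)))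

/-- Dirichlet's unit theorem: up to functions supported at the distinguished infinite place, the
logarithms of units span all functions of the infinite places. -/
lemma exists_mem_unitLogSpan_sub_eq_single (F : Type) [Field F] [NumberField F]
    [DecidableEq (InfinitePlace F)] (H : InfinitePlace F → ℝ) :
    ∃ s ∈ unitLogSpan F, ∃ c : ℝ,
      H = s + c • Pi.single (Units.dirichletUnitTheorem.w₀ : InfinitePlace F) 1 := by
  let R : (InfinitePlace F → ℝ) →ₗ[ℝ] Units.dirichletUnitTheorem.logSpace F :=
    { toFun := fun H w => w.1.mult * H w.1
      map_add' := fun H H' => by funext w; simp [mul_add]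
      map_smul' := fun c H => by funext w; simp; ring }
  have hR : (unitLogSpan F).map R = ⊤ := by
    rw [unitLogSpan, Submodule.map_span, ← top_le_iff,
      ← Units.dirichletUnitTheorem.unitLattice_span_eq_top]
    refine Submodule.span_mono ?_
    rintro _ ⟨u, -, rfl⟩
    exact ⟨_, ⟨u.toMul, rfl⟩, rfl⟩
  obtain ⟨s, hs, hsH⟩ : R H ∈ (unitLogSpan F).map R := hR ▸ Submodule.mem_top
  refine ⟨s, hs, H Units.dirichletUnitTheorem.w₀ - s Units.dirichletUnitTheorem.w₀, ?_⟩
  funext w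
  by_cases hw : w = Units.dirichletUnitTheorem.w₀
  · subst hw
    simp
  · have h1 : (w.mult : ℝ) * s w = w.mult * H w := congrFun hsH ⟨w, hw⟩
    have h2 : (w.mult : ℝ) ≠ 0 := by exact_mod_cast InfinitePlace.mult_ne_zero
    simp [hw, mul_left_cancel₀ h2 h1]

section

variable {S : Set PlaceSpace}

lemma ofInfinitePlaces_mem_sUnitSpan (hS : IsClosed S) (harch : PlaceSpace.archimedean ⊆ S)
    (L : NumField) {H : InfinitePlace L.1 → ℝ} (hH : H ∈ unitLogSpan L.1) :
    ofInfinitePlaces L H ∈ sUnitSpan S := by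
  have : (unitLogSpan L.1).map (ofInfinitePlaces L) ≤ sUnitSpan S := by
    rw [unitLogSpan, Submodule.map_span, Submodule.span_le]
    rintro _ ⟨_, ⟨u, rfl⟩, rfl⟩
    have hone : ∀ y : PlaceSpace, ¬ (y.1 L).IsArchimedean → (y.1 L).1 ((u : 𝓞 L.1) : L.1) = 1 :=
      fun y hy => AbsoluteValue.apply_unit_eq_one (Place.isNonarchimedean hy) u
    have h := log_integer_mem_sUnitFun hS L u.ne_zero fun y hy =>
      hone y fun h => hy (harch ((y.mem_archimedean_iff L).2 h))
    suffices heq : ofInfinitePlaces L (fun w => Real.log (w ((u : 𝓞 L.1) : L.1)))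
        = fun y => Real.log ((y.1 L).1 ((u : 𝓞 L.1) : L.1)) from
      Submodule.subset_span (heq ▸ h)
    funext y
    by_cases hy : (y.1 L).IsArchimedean
    · simp only [ofInfinitePlaces, LinearMap.coe_mk, AddHom.coe_mk, dif_pos hy]
      rw [(Place.exists_infinitePlace hy).choose_spec]
    · simp only [ofInfinitePlaces, LinearMap.coe_mk, AddHom.coe_mk, dif_neg hy]
      rw [hone y hy, Real.log_one]
  exact this (Submodule.mem_map_of_mem hH)

lemma ofInfinitePlaces_one (L : NumField) :
    ofInfinitePlaces L 1 = PlaceSpace.archimedean.indicator 1 := by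
  funext y
  by_cases hy : (y.1 L).IsArchimedean
  · simp [ofInfinitePlaces, hy, (y.mem_archimedean_iff L).2 hy]
  · have : y ∉ PlaceSpace.archimedean := fun h => hy ((y.mem_archimedean_iff L).1 h)
    simp [ofInfinitePlaces, hy, this]

lemma avMeasure_real_archimedean_pos (hS : IsCompact S) (harch : PlaceSpace.archimedean ⊆ S) :
    0 < avMeasure.real PlaceSpace.archimedean := by
  refine ENNReal.toReal_pos ?_ ((measure_mono harch).trans_lt hS.measure_lt_top).ne
  exact (zero_lt_one.trans_le one_le_avMeasure_archimedean).ne'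

/-- The real vector space spanned by the functions of the algebraic `S`-units and by the indicator
function of the archimedean places. -/
def extendedSpan (S : Set PlaceSpace) : Submodule ℝ (PlaceSpace → ℝ) :=
  sUnitSpan S ⊔ Submodule.span ℝ {PlaceSpace.archimedean.indicator 1}

/-- Functions of the infinite places of `L` are combinations of units and a constant: by Dirichlet's
theorem the units have codimension at most one, and constants are not in their span since their
integral is nonzero. -/
lemma ofInfinitePlaces_mem_extendedSpan (hS : IsCompact S) (harch : PlaceSpace.archimedean ⊆ S)
    (L : NumField) (H : InfinitePlace L.1 → ℝ) : ofInfinitePlaces L H ∈ extendedSpan S := by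
  classical
  obtain ⟨s, hs, c, h1⟩ := exists_mem_unitLogSpan_sub_eq_single L.1 1
  obtain ⟨t, ht, d, hH⟩ := exists_mem_unitLogSpan_sub_eq_single L.1 H
  have hs' := ofInfinitePlaces_mem_sUnitSpan hS.isClosed harch L hs
  have ht' := ofInfinitePlaces_mem_sUnitSpan hS.isClosed harch L ht
  have hc : c ≠ 0 := by
    rintro rfl
    rw [zero_smul, add_zero] at h1
    rw [← h1, ofInfinitePlaces_one] at hs'
    have h2 := (properties_of_mem_sUnitSpan hS hs').2.2
    rw [integral_indicator_one PlaceSpace.isClopen_archimedean.isOpen.measurableSet] at h2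
    exact (avMeasure_real_archimedean_pos hS harch).ne' h2
  have h3 : H = t + (d * c⁻¹) • (1 - s) := by
    rw [hH, h1, add_sub_cancel_left, smul_smul, inv_mul_cancel_right₀ hc]
  rw [h3, map_add, map_smul, map_sub, ofInfinitePlaces_one]
  have hone : PlaceSpace.archimedean.indicator 1 ∈ extendedSpan S :=
    (le_sup_right : _ ≤ extendedSpan S) (Submodule.mem_span_singleton_self _)
  have hle : sUnitSpan S ≤ extendedSpan S := le_sup_left
  exact add_mem (hle ht') (Submodule.smul_mem _ _ (sub_mem hone (hle hs')))

lemma archimedean_level_mem_extendedSpan (hS : IsCompact S)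
    (harch : PlaceSpace.archimedean ⊆ S) (L : NumField) (h : Place L.1 → ℝ)
    (hh : ∀ v, ¬ v.IsArchimedean → h v = 0) : (fun y => h (y.1 L)) ∈ extendedSpan S := by
  classical
  convert ofInfinitePlaces_mem_extendedSpan hS harch L
    (fun w => if hw : ∃ v : Place L.1, ∀ x, v.1 x = w x then h hw.choose else 0) using 1
  funext y
  by_cases hy : (y.1 L).IsArchimedean
  · have hspec := (Place.exists_infinitePlace hy).choose_spec
    have hw : ∃ v : Place L.1, ∀ x, v.1 x = (Place.exists_infinitePlace hy).choose x := ⟨_, hspec⟩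
    simp only [ofInfinitePlaces, LinearMap.coe_mk, AddHom.coe_mk, dif_pos hy, dif_pos hw]
    rw [Place.ext_of_infinitePlace hw.choose_spec hspec]
  · simp only [ofInfinitePlaces, LinearMap.coe_mk, AddHom.coe_mk, dif_neg hy]
    exact hh _ hy

/-- The indicator function of the places over `v`. If `v` is nonarchimedean, it is, up to a factor
and a function supported at the archimedean places, the function of an integer which is a unit away
from `v`. -/
lemma indicator_above_mem_extendedSpan (hS : IsCompact S)
    (harch : PlaceSpace.archimedean ⊆ S) (L : NumField) (v : Place L.1)
    (hv : PlaceSpace.above L v ⊆ S) : (PlaceSpace.above L v).indicator 1 ∈ extendedSpan S := by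
  classical
  by_cases hva : v.IsArchimedean
  · have h2 := archimedean_level_mem_extendedSpan hS harch L (fun w => if w = v then 1 else 0)
      fun w hw => if_neg (by rintro rfl; exact hw hva)
    convert h2 using 1
    funext y
    simp [Set.indicator_apply, PlaceSpace.above]
  · obtain ⟨π, hπ0, hπ, hπ1⟩ := Place.exists_integer_apply_lt_one hva
    have hmem := log_integer_mem_sUnitFun hS.isClosed L hπ0 fun y hy =>
      hπ1 (y.1 L) (fun h => hy (harch ((y.mem_archimedean_iff L).2 h))) fun h => hy (hv h)
    have hmem' : (fun y : PlaceSpace => Real.log ((y.1 L).1 (π : L.1))) ∈ extendedSpan S :=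
      (le_sup_left : _ ≤ extendedSpan S) (Submodule.subset_span hmem)
    have h2 := archimedean_level_mem_extendedSpan hS harch L
      (fun w => if w.IsArchimedean then Real.log (w.1 (π : L.1)) else 0)
      fun w hw => if_neg hw
    have hpos : 0 < v.1 (π : L.1) := v.1.pos (by simpa using hπ0)
    have hne : Real.log (v.1 (π : L.1)) ≠ 0 := (Real.log_neg hpos hπ).ne
    convert Submodule.smul_mem _ (Real.log (v.1 (π : L.1)))⁻¹ (sub_mem hmem' h2) using 1
    funext y
    simp only [Pi.smul_apply, Pi.sub_apply, smul_eq_mul]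
    by_cases hy : y.1 L = v
    · have h3 : y ∈ PlaceSpace.above L v := hy
      rw [Set.indicator_of_mem h3, hy, if_neg hva, sub_zero, inv_mul_cancel₀ hne, Pi.one_apply]
    · have h3 : y ∉ PlaceSpace.above L v := hy
      rw [Set.indicator_of_notMem h3]
      by_cases hya : (y.1 L).IsArchimedean
      · rw [if_pos hya, sub_self, mul_zero]
      · rw [if_neg hya, hπ1 _ hya hy, Real.log_one, sub_self, mul_zero]

/-- Locally constant functions supported in `S` are combinations of `S`-units and of the indicator
function of the archimedean places. -/
lemma level_mem_extendedSpan (hS : IsCompact S) (harch : PlaceSpace.archimedean ⊆ S)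
    (L : NumField) (T : Finset (Place L.1)) (hT : ∀ v ∈ T, PlaceSpace.above L v ⊆ S)
    (h : Place L.1 → ℝ) (hh : ∀ v ∉ T, h v = 0) : (fun y => h (y.1 L)) ∈ extendedSpan S := by
  have heq : (fun y : PlaceSpace => h (y.1 L))
      = ∑ v ∈ T, h v • (PlaceSpace.above L v).indicator (1 : PlaceSpace → ℝ) := by
    classical
    funext y
    rw [Finset.sum_apply]
    by_cases hy : y.1 L ∈ T
    · rw [Finset.sum_eq_single_of_mem _ hy fun v _ hv => ?_]
      · have h3 : y ∈ PlaceSpace.above L (y.1 L) := rfl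
        simp [h3]
      · have h3 : y ∉ PlaceSpace.above L v := fun h => hv h.symm
        simp [h3]
    · rw [hh _ hy, Finset.sum_eq_zero fun v hv => ?_]
      have h3 : y ∉ PlaceSpace.above L v := fun h => hy (h ▸ hv)
      simp [h3]
  rw [heq]
  exact Submodule.sum_mem _ fun v hv =>
    Submodule.smul_mem _ _ (indicator_above_mem_extendedSpan hS harch L v (hT v hv))

end

end

/-! ### Density in the supremum norm -/

section

variable {S : Set PlaceSpace}

/-- A continuous function with support in a compact open set, as an element of `C₀(Y)`. -/
def c0OfSupport (hS : IsCompact S) (f : PlaceSpace → ℝ) (hf : Continuous f)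
    (hfS : Function.support f ⊆ S) : C₀(PlaceSpace, ℝ) :=
  ⟨⟨f, hf⟩, HasCompactSupport.is_zero_at_infty
    (hS.of_isClosed_subset (isClosed_tsupport f) (closure_minimal hfS hS.isClosed))⟩

@[simp] lemma coe_c0OfSupport (hS : IsCompact S) (f : PlaceSpace → ℝ) (hf : Continuous f)
    (hfS : Function.support f ⊆ S) : ⇑(c0OfSupport hS f hf hfS) = f := rfl

/-- The elements of `C₀(Y)` given by `S`-units. -/
def sUnitC0 (S : Set PlaceSpace) : AddSubgroup C₀(PlaceSpace, ℝ) where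
  carrier := c0Functions (sUnitFun S : Set (PlaceSpace → ℝ))
  zero_mem' := (sUnitFun S).zero_mem
  add_mem' := fun hf hg => (sUnitFun S).add_mem hf hg
  neg_mem' := fun hf => (sUnitFun S).neg_mem hf

/-- The uniform closure of the rational vector space of `S`-units is a real vector space. -/
lemma smul_mem_closure_sUnitC0 (r : ℝ) {g : C₀(PlaceSpace, ℝ)}
    (hg : g ∈ closure (sUnitC0 S : Set C₀(PlaceSpace, ℝ))) :
    r • g ∈ closure (sUnitC0 S : Set C₀(PlaceSpace, ℝ)) := by
  have hclosed : IsClosed {r : ℝ | r • g ∈ closure (sUnitC0 S : Set C₀(PlaceSpace, ℝ))} :=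
    isClosed_closure.preimage (continuous_id.smul continuous_const)
  refine hclosed.closure_subset_iff.2 ?_ (Rat.denseRange_cast r)
  rintro _ ⟨q, rfl⟩
  refine map_mem_closure (continuous_const_smul (q : ℝ)) hg fun h hh => ?_
  have h1 := (sUnitFun S).smul_mem q hh
  have h2 : q • (⇑h : PlaceSpace → ℝ) = ⇑((q : ℝ) • h) := by
    funext y
    simp [Rat.smul_def]
  rw [h2] at h1
  exact h1

lemma exists_mem_closure_of_mem_sUnitSpan (hS : IsCompact S) {a : PlaceSpace → ℝ}
    (ha : a ∈ sUnitSpan S) :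
    ∃ g ∈ closure (sUnitC0 S : Set C₀(PlaceSpace, ℝ)), ⇑g = a := by
  induction ha using Submodule.span_induction with
  | mem f hf =>
    obtain ⟨h1, h2, -⟩ := properties_of_mem_sUnitFun hS hf
    exact ⟨c0OfSupport hS f h1 h2, subset_closure hf, rfl⟩
  | zero => exact ⟨0, (sUnitC0 S).topologicalClosure.zero_mem, rfl⟩
  | add f g _ _ hf hg =>
    obtain ⟨f', hf', rfl⟩ := hf
    obtain ⟨g', hg', rfl⟩ := hg
    exact ⟨f' + g', (sUnitC0 S).topologicalClosure.add_mem hf' hg', rfl⟩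
  | smul c f _ hf =>
    obtain ⟨f', hf', rfl⟩ := hf
    exact ⟨c • f', smul_mem_closure_sUnitC0 c hf', rfl⟩

/-- Continuous functions with support in `S` are uniform limits of functions factoring through the
places of a number field, which are combinations of `S`-units and of the indicator function of the
archimedean places. -/
lemma exists_mem_extendedSpan_near (hS : IsCompact S) (hSo : IsOpen S)
    (harch : PlaceSpace.archimedean ⊆ S) {f : PlaceSpace → ℝ} (hf : Continuous f)
    (hfS : Function.support f ⊆ S) {ε : ℝ} (hε : 0 < ε) :
    ∃ g ∈ extendedSpan S, ∀ y, |f y - g y| ≤ ε := by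
  classical
  have hK : ∀ y ∈ S, ∃ K : NumField,
      PlaceSpace.above K (y.1 K) ⊆ S ∩ {z | |f z - f y| < ε / 2} := fun y hy => by
    refine PlaceSpace.exists_above_subset (hSo.inter ?_) ⟨hy, by simp [hε]⟩
    exact isOpen_lt (hf.sub continuous_const).abs continuous_const
  have : Nonempty NumField := ⟨rationals⟩
  choose! K hK using hK
  obtain ⟨t, htS, ht⟩ := hS.elim_nhds_subcover (fun y => PlaceSpace.above (K y) (y.1 (K y)))
    fun y _ => (PlaceSpace.isClopen_above _ _).isOpen.mem_nhds rfl
  obtain ⟨L, hL⟩ := PlaceSpace.exists_le_of_finset (t.image K)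
  -- Two places which agree on `L`, one of them in `S`, lie in the same set of the covering.
  have hsame : ∀ z z' : PlaceSpace, z ∈ S → z'.1 L = z.1 L → z' ∈ S ∧ |f z - f z'| ≤ ε := by
    intro z z' hz hzz'
    obtain ⟨y, hy, hzy⟩ := Set.mem_iUnion₂.1 (ht hz)
    have hz'y : z' ∈ PlaceSpace.above (K y) (y.1 (K y)) :=
      (PlaceSpace.eval_eq_of_le (hL _ (Finset.mem_image_of_mem K hy)) hzz').trans hzy
    have h1 := hK y (htS y hy) hzy
    have h2 := hK y (htS y hy) hz'y
    refine ⟨h2.1, ?_⟩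
    have h3 : |f z - f y| < ε / 2 := h1.2
    have h4 : |f z' - f y| < ε / 2 := h2.2
    rw [abs_sub_comm] at h4
    linarith [abs_sub_le (f z) (f y) (f z')]
  have hfin : ((fun y : PlaceSpace => y.1 L) '' S).Finite :=
    (hS.image (PlaceSpace.continuous_eval L)).finite_of_discrete
  let h : Place L.1 → ℝ := fun v =>
    if hv : ∃ z ∈ S, z.1 L = v then f hv.choose else 0
  refine ⟨fun y => h (y.1 L), level_mem_extendedSpan hS harch L hfin.toFinset ?_ h ?_, fun y => ?_⟩
  · intro v hv z hz
    obtain ⟨z', hz', rfl⟩ := hfin.mem_toFinset.1 hv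
    exact (hsame z' z hz' hz).1
  · intro v hv
    exact dif_neg fun hv' => hv (hfin.mem_toFinset.2 hv')
  · by_cases hy : ∃ z ∈ S, z.1 L = y.1 L
    · simp only [h, dif_pos hy]
      have h1 := hsame _ y hy.choose_spec.1 hy.choose_spec.2.symm
      rw [abs_sub_comm]
      exact h1.2
    · simp only [h, dif_neg hy]
      have hyS : f y = 0 := by
        by_contra hne
        exact hy ⟨y, hfS hne, rfl⟩
      simp [hyS, hε.le]

lemma mem_c0Hyperplane_iff (hS : IsClosed S) {f : C₀(PlaceSpace, ℝ)} :
    f ∈ c0Hyperplane S ↔ (∀ y ∉ S, f y = 0) ∧ ∫ y in S, f y ∂avMeasure = 0 := by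
  refine and_congr_left fun _ => ⟨fun h y hy => ?_, fun h => closure_minimal (fun y hy => ?_) hS⟩
  · by_contra hne
    exact hy (h (subset_tsupport _ hne))
  · by_contra hyS
    exact hy (h y hyS)

lemma abs_apply_sub_le_dist (f g : C₀(PlaceSpace, ℝ)) (y : PlaceSpace) :
    |f y - g y| ≤ dist f g := by
  rw [← ZeroAtInftyContinuousMap.dist_toBCF_eq_dist, ← Real.dist_eq]
  exact BoundedContinuousFunction.dist_coe_le_dist (f := f.toBCF) (g := g.toBCF) y

lemma dist_le_of_abs_apply_sub_le {f g : C₀(PlaceSpace, ℝ)} {C : ℝ} (hC : 0 ≤ C)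
    (h : ∀ y, |f y - g y| ≤ C) : dist f g ≤ C := by
  rw [← ZeroAtInftyContinuousMap.dist_toBCF_eq_dist]
  exact (BoundedContinuousFunction.dist_le hC).2 h

lemma abs_setIntegral_le (hS : IsCompact S) {f : PlaceSpace → ℝ} {C : ℝ} (h : ∀ y, |f y| ≤ C) :
    |∫ y in S, f y ∂avMeasure| ≤ C * avMeasure.real S :=
  norm_setIntegral_le_of_norm_le_const (f := f) hS.measure_lt_top fun y _ => h y

lemma integrableOn_c0 (hS : IsCompact S) (f : C₀(PlaceSpace, ℝ)) : IntegrableOn f S avMeasure :=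
  f.continuous.continuousOn.integrableOn_compact hS

lemma isClosed_c0Hyperplane (hS : IsCompact S) : IsClosed (c0Hyperplane S) := by
  have heq : c0Hyperplane S = (⋂ y ∈ Sᶜ, {f : C₀(PlaceSpace, ℝ) | f y = 0}) ∩
      {f : C₀(PlaceSpace, ℝ) | ∫ y in S, f y ∂avMeasure = 0} := by
    ext f
    simp [mem_c0Hyperplane_iff hS.isClosed]
  rw [heq]
  refine IsClosed.inter (isClosed_biInter fun y _ => isClosed_eq ?_ continuous_const)
    (isClosed_eq ?_ continuous_const)
  · refine (LipschitzWith.of_dist_le_mul (K := 1) fun f g => ?_).continuous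
    rw [NNReal.coe_one, one_mul]
    exact abs_apply_sub_le_dist f g y
  · refine
      (LipschitzWith.of_dist_le_mul (K := (avMeasure.real S).toNNReal) fun f g => ?_).continuous
    rw [Real.dist_eq, ← integral_sub (integrableOn_c0 hS f) (integrableOn_c0 hS g),
      Real.coe_toNNReal _ measureReal_nonneg, mul_comm]
    exact abs_setIntegral_le hS fun y => abs_apply_sub_le_dist f g y

lemma sUnitC0_subset_c0Hyperplane (hS : IsCompact S) :
    c0Functions (sUnitFun S : Set (PlaceSpace → ℝ)) ⊆ c0Hyperplane S := fun f hf => by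
  obtain ⟨-, h2, h3⟩ := properties_of_mem_sUnitFun hS hf
  exact ⟨hf.2, (setIntegral_eq_integral_of_forall_compl_eq_zero fun y hy => by
    by_contra hne
    exact hy (h2 hne)).trans h3⟩

/-- The indicator function of the archimedean places, as an element of `C₀(Y)`. -/
def archC0 (hS : IsCompact S) (harch : PlaceSpace.archimedean ⊆ S) : C₀(PlaceSpace, ℝ) :=
  c0OfSupport hS (PlaceSpace.archimedean.indicator 1)
    (IsClopen.continuous_indicator PlaceSpace.isClopen_archimedean continuous_one)
    (Set.support_indicator_subset.trans harch)

lemma setIntegral_indicator_archimedean (harch : PlaceSpace.archimedean ⊆ S) :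
    ∫ y in S, PlaceSpace.archimedean.indicator (1 : PlaceSpace → ℝ) y ∂avMeasure =
      avMeasure.real PlaceSpace.archimedean := by
  rw [integral_indicator_one PlaceSpace.isClopen_archimedean.isOpen.measurableSet,
    measureReal_restrict_apply PlaceSpace.isClopen_archimedean.isOpen.measurableSet,
    Set.inter_eq_left.2 harch]

/-- Density of the `S`-units for the supremum norm. -/
lemma c0Hyperplane_subset_closure (hS : IsCompact S) (hSo : IsOpen S)
    (harch : PlaceSpace.archimedean ⊆ S) :
    c0Hyperplane S ⊆ closure (c0Functions (sUnitFun S : Set (PlaceSpace → ℝ))) := by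
  intro f hf
  have hfS := hf
  rw [mem_c0Hyperplane_iff hS.isClosed] at hfS
  have hsupp : Function.support f ⊆ S := fun y hy => by
    by_contra hyS
    exact hy (hfS.1 y hyS)
  set m := avMeasure.real PlaceSpace.archimedean
  have hm0 : 0 < m := avMeasure_real_archimedean_pos hS harch
  change f ∈ closure (sUnitC0 S : Set C₀(PlaceSpace, ℝ))
  rw [← closure_closure, Metric.mem_closure_iff]
  intro δ hδ
  have hB : 0 < 2 * (1 + avMeasure.real S / m) := by positivity
  set ε := δ / (2 * (1 + avMeasure.real S / m)) with hεdef
  have hε : 0 < ε := div_pos hδ hB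
  obtain ⟨g, hg, hfg⟩ :=
    exists_mem_extendedSpan_near hS hSo harch (f := f) (map_continuous f) hsupp hε
  obtain ⟨a, ha, b, hb, rfl⟩ := Submodule.mem_sup.1 hg
  obtain ⟨c, rfl⟩ := Submodule.mem_span_singleton.1 hb
  obtain ⟨u, hu, rfl⟩ := exists_mem_closure_of_mem_sUnitSpan hS ha
  refine ⟨u, hu, ?_⟩
  -- The coefficient `c` of the archimedean part is small since `f` and `u` have integral zero.
  have hu0 : ∫ y in S, u y ∂avMeasure = 0 :=
    (closure_minimal (sUnitC0_subset_c0Hyperplane hS) (isClosed_c0Hyperplane hS) hu).2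
  have hint := abs_setIntegral_le hS hfg
  have heq : ∫ y in S,
      (f y - (⇑u + c • PlaceSpace.archimedean.indicator 1 : PlaceSpace → ℝ) y) ∂avMeasure
      = -(c * m) := by
    have h1 : IntegrableOn (fun y => c * PlaceSpace.archimedean.indicator (1 : PlaceSpace → ℝ) y) S
        avMeasure := (integrableOn_c0 hS (archC0 hS harch)).const_mul c
    have h2 : IntegrableOn (fun y => u y + c * PlaceSpace.archimedean.indicator 1 y) S avMeasure :=
      (integrableOn_c0 hS u).add h1
    simp only [Pi.add_apply, Pi.smul_apply, smul_eq_mul]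
    rw [integral_sub (integrableOn_c0 hS f) h2,
      integral_add (integrableOn_c0 hS u) h1, hfS.2, hu0, integral_const_mul,
      setIntegral_indicator_archimedean harch, zero_add, zero_sub]
  rw [heq, abs_neg, abs_mul, abs_of_pos hm0] at hint
  have hc : |c| ≤ ε * (avMeasure.real S / m) := by
    rw [← mul_div_assoc, le_div_iff₀ hm0]
    exact hint
  have hbound : dist f u ≤ ε * (1 + avMeasure.real S / m) := by
    refine dist_le_of_abs_apply_sub_le (by positivity) fun y => ?_
    have h2 := hfg y
    have h3 : |c * PlaceSpace.archimedean.indicator (1 : PlaceSpace → ℝ) y| ≤ |c| := by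
      by_cases hy : y ∈ PlaceSpace.archimedean <;> simp [hy]
    simp only [Pi.add_apply, Pi.smul_apply, smul_eq_mul] at h2
    have h4 := abs_add_le (f y - (u y + c * PlaceSpace.archimedean.indicator (1 : PlaceSpace → ℝ) y))
      (c * PlaceSpace.archimedean.indicator (1 : PlaceSpace → ℝ) y)
    have h5 : f y - (u y + c * PlaceSpace.archimedean.indicator (1 : PlaceSpace → ℝ) y)
      + c * PlaceSpace.archimedean.indicator (1 : PlaceSpace → ℝ) y = f y - u y := by ring
    rw [h5] at h4
    linarith
  have hδε : ε * (1 + avMeasure.real S / m) = δ / 2 := by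
    rw [hεdef]
    field_simp
  linarith

end

/-! ### Density in the `L^p` norm -/

section

variable {S : Set PlaceSpace} {p : ℝ≥0∞}

/-- Integration over `S` is bounded on `L^p` by Hölder's inequality, `S` having finite measure. -/
lemma exists_abs_setIntegral_lp_le (hS : IsCompact S) [hp : Fact (1 ≤ p)] :
    ∃ C : ℝ, ∀ f : Lp ℝ p avMeasure, |∫ y in S, f y ∂avMeasure| ≤ C * ‖f‖ := by
  set D : ℝ≥0∞ := (avMeasure.restrict S) Set.univ ^ (1 / (1 : ℝ≥0∞).toReal - 1 / p.toReal)
  have hDtop : D ≠ ∞ := by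
    refine ENNReal.rpow_ne_top_of_nonneg ?_ ?_
    · rcases eq_or_ne p ∞ with rfl | hptop
      · simp
      · have h1 : 1 ≤ p.toReal := by
          simpa using ENNReal.toReal_mono hptop hp.out
        simpa using inv_le_one_of_one_le₀ h1
    · simpa using hS.measure_lt_top.ne
  refine ⟨D.toReal, fun f => ?_⟩
  have h1 : ‖∫ y in S, f y ∂avMeasure‖ₑ ≤ eLpNorm f p avMeasure * D := by
    calc ‖∫ y in S, f y ∂avMeasure‖ₑ ≤ ∫⁻ y in S, ‖f y‖ₑ ∂avMeasure :=
          enorm_integral_le_lintegral_enorm _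
      _ = eLpNorm f 1 (avMeasure.restrict S) := eLpNorm_one_eq_lintegral_enorm.symm
      _ ≤ eLpNorm f p (avMeasure.restrict S) * D :=
          eLpNorm_le_eLpNorm_mul_rpow_measure_univ hp.out (Lp.aestronglyMeasurable f).restrict
      _ ≤ eLpNorm f p avMeasure * D := by
          gcongr
          exact Measure.restrict_le_self
  have h2 := ENNReal.toReal_mono (ENNReal.mul_ne_top (Lp.eLpNorm_ne_top f) hDtop) h1
  rw [ENNReal.toReal_mul, mul_comm] at h2
  simpa [Lp.norm_def] using h2

lemma integrableOn_lp (hS : IsCompact S) [hp : Fact (1 ≤ p)] (f : Lp ℝ p avMeasure) :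
    IntegrableOn f S avMeasure := by
  have : IsFiniteMeasure (avMeasure.restrict S) := ⟨by simpa using hS.measure_lt_top⟩
  exact ((Lp.memLp f).restrict S).integrable hp.out

lemma continuous_setIntegral_lp (hS : IsCompact S) [hp : Fact (1 ≤ p)] :
    Continuous fun f : Lp ℝ p avMeasure => ∫ y in S, f y ∂avMeasure := by
  obtain ⟨C, hC⟩ := exists_abs_setIntegral_lp_le (p := p) hS
  refine (LipschitzWith.of_dist_le_mul (K := C.toNNReal) fun f g => ?_).continuous
  have h1 : ∫ y in S, (f - g) y ∂avMeasure
      = ∫ y in S, f y ∂avMeasure - ∫ y in S, g y ∂avMeasure := by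
    rw [← integral_sub (integrableOn_lp hS f) (integrableOn_lp hS g)]
    exact integral_congr_ae (ae_restrict_of_ae (Lp.coeFn_sub f g))
  rw [Real.dist_eq, ← h1, dist_eq_norm]
  refine (hC (f - g)).trans ?_
  gcongr
  exact Real.le_coe_toNNReal C

lemma isClosed_lpHyperplane (hS : IsCompact S) [hp : Fact (1 ≤ p)] :
    IsClosed (lpHyperplane p S) := by
  refine IsClosed.inter ?_ (isClosed_eq (continuous_setIntegral_lp hS) continuous_const)
  have heq : {f : Lp ℝ p avMeasure | ∀ᵐ y ∂avMeasure, y ∉ S → f y = 0} =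
      (LpToLpRestrictCLM PlaceSpace ℝ ℝ avMeasure p Sᶜ) ⁻¹' {0} := by
    ext f
    have h := LpToLpRestrictCLM_coeFn ℝ Sᶜ f
    refine (ae_restrict_iff' hS.measurableSet.compl).symm.trans (Iff.trans ?_
      (Lp.eq_zero_iff_ae_eq_zero (f := LpToLpRestrictCLM PlaceSpace ℝ ℝ avMeasure p Sᶜ f)).symm)
    exact ⟨fun h1 => h.trans h1, fun h1 => h.symm.trans h1⟩
  change IsClosed {f : Lp ℝ p avMeasure | ∀ᵐ y ∂avMeasure, y ∉ S → f y = 0}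
  rw [heq]
  exact isClosed_singleton.preimage (LpToLpRestrictCLM _ _ ℝ _ _ _).continuous

lemma lpClasses_subset_lpHyperplane (hS : IsCompact S) :
    lpClasses p (sUnitFun S : Set (PlaceSpace → ℝ)) ⊆ lpHyperplane p S := by
  rintro g ⟨f, hf, hgf⟩
  obtain ⟨-, h2, h3⟩ := properties_of_mem_sUnitFun hS hf
  have h4 : ∀ y ∉ S, f y = 0 := fun y hy => by
    by_contra hne
    exact hy (h2 hne)
  refine ⟨hgf.mono fun y hy hyS => hy.trans (h4 y hyS), ?_⟩
  rw [integral_congr_ae (ae_restrict_of_ae hgf)]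
  exact (setIntegral_eq_integral_of_forall_compl_eq_zero h4).trans h3

lemma aestronglyMeasurable_indicator (hS : IsCompact S) {f : PlaceSpace → ℝ} (hf : Continuous f) :
    AEStronglyMeasurable (S.indicator f) avMeasure :=
  (hf.measurable.indicator hS.measurableSet).aestronglyMeasurable

lemma eLpNorm_indicator_le (hS : IsCompact S) {f : PlaceSpace → ℝ} {C : ℝ}
    (hC : ∀ y, |f y| ≤ C) :
    eLpNorm (S.indicator f) p avMeasure ≤ avMeasure S ^ p.toReal⁻¹ * ENNReal.ofReal C := by
  rw [eLpNorm_indicator_eq_eLpNorm_restrict hS.measurableSet]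
  refine (eLpNorm_le_of_ae_bound (Filter.Eventually.of_forall hC)).trans (le_of_eq ?_)
  simp

lemma rpow_avMeasure_ne_top (hS : IsCompact S) : avMeasure S ^ p.toReal⁻¹ ≠ ∞ :=
  ENNReal.rpow_ne_top_of_nonneg (by positivity) hS.measure_lt_top.ne

lemma abs_apply_le_norm (f : C₀(PlaceSpace, ℝ)) (y : PlaceSpace) : |f y| ≤ ‖f‖ := by
  simpa using abs_apply_sub_le_dist f 0 y

lemma memLp_indicator_c0 (hS : IsCompact S) (f : C₀(PlaceSpace, ℝ)) :
    MemLp (S.indicator f) p avMeasure :=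
  ⟨aestronglyMeasurable_indicator hS f.continuous,
    (eLpNorm_indicator_le hS (abs_apply_le_norm f)).trans_lt
      (ENNReal.mul_lt_top (rpow_avMeasure_ne_top hS).lt_top ENNReal.ofReal_lt_top)⟩

/-- Multiplication by the indicator function of a compact set `S`, as a linear map from `C₀(Y)` to
`L^p`. -/
def c0ToLp (p : ℝ≥0∞) [Fact (1 ≤ p)] (hS : IsCompact S) :
    C₀(PlaceSpace, ℝ) →ₗ[ℝ] Lp ℝ p avMeasure where
  toFun f := (memLp_indicator_c0 hS f).toLp _
  map_add' f g := by
    rw [← MemLp.toLp_add]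
    congr 1
    exact Set.indicator_add S f g
  map_smul' c f := by
    rw [RingHom.id_apply, ← MemLp.toLp_const_smul]
    congr 1
    exact Set.indicator_const_smul S c f

lemma c0ToLp_coeFn [Fact (1 ≤ p)] (hS : IsCompact S) (f : C₀(PlaceSpace, ℝ)) :
    c0ToLp p hS f =ᵐ[avMeasure] S.indicator f :=
  (memLp_indicator_c0 hS f).coeFn_toLp

lemma continuous_c0ToLp [Fact (1 ≤ p)] (hS : IsCompact S) : Continuous (c0ToLp p hS) := by
  refine AddMonoidHomClass.continuous_of_bound (c0ToLp p hS) (avMeasure S ^ p.toReal⁻¹).toReal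
    fun f => ?_
  have h1 := eLpNorm_indicator_le (p := p) hS (abs_apply_le_norm f)
  have h2 := ENNReal.toReal_mono
    (ENNReal.mul_ne_top (rpow_avMeasure_ne_top hS) ENNReal.ofReal_ne_top) h1
  rw [ENNReal.toReal_mul, ENNReal.toReal_ofReal (norm_nonneg f)] at h2
  exact (Lp.norm_toLp _ (memLp_indicator_c0 hS f)).trans_le h2

lemma setIntegral_c0ToLp [Fact (1 ≤ p)] (hS : IsCompact S) (f : C₀(PlaceSpace, ℝ)) :
    ∫ y in S, c0ToLp p hS f y ∂avMeasure = ∫ y in S, f y ∂avMeasure := by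
  rw [integral_congr_ae (ae_restrict_of_ae (c0ToLp_coeFn hS f))]
  exact setIntegral_congr_fun hS.measurableSet fun y hy => Set.indicator_of_mem hy _

/-- Restriction to `S` maps the uniform closure of the `S`-units to their `L^p` closure. -/
lemma c0ToLp_mem_closure [Fact (1 ≤ p)] (hS : IsCompact S) {f : C₀(PlaceSpace, ℝ)}
    (hf : f ∈ closure (c0Functions (sUnitFun S : Set (PlaceSpace → ℝ)))) :
    c0ToLp p hS f ∈ closure (lpClasses p (sUnitFun S : Set (PlaceSpace → ℝ))) := by
  refine map_mem_closure (continuous_c0ToLp hS) hf fun g hg => ⟨g, hg, ?_⟩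
  have h := (properties_of_mem_sUnitFun hS hg).2.1
  have h2 := c0ToLp_coeFn (p := p) hS g
  rwa [Set.indicator_eq_self.2 h] at h2

/-- Elements of `L^p` with support in `S` are limits of continuous functions with support in `S`. -/
lemma mem_closure_c0ToLp_image [Fact (1 ≤ p)] (hp : p ≠ ∞) (hS : IsCompact S) (hSo : IsOpen S)
    {f : Lp ℝ p avMeasure} (hf : ∀ᵐ y ∂avMeasure, y ∉ S → f y = 0) :
    f ∈ closure (c0ToLp p hS '' {g | Function.support g ⊆ S}) := by
  have : IsFiniteMeasure (avMeasure.restrict S) := ⟨by simpa using hS.measure_lt_top⟩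
  rw [Metric.mem_closure_iff]
  intro ε hε
  obtain ⟨g, hg, -⟩ := ((Lp.memLp f).restrict S).exists_boundedContinuous_eLpNorm_sub_le hp
    (ε := ENNReal.ofReal (ε / 2)) (by simpa using hε)
  have hcont : Continuous (S.indicator g) :=
    IsClopen.continuous_indicator ⟨hS.isClosed, hSo⟩ g.continuous
  let g' := c0OfSupport hS (S.indicator g) hcont Set.support_indicator_subset
  refine ⟨_, ⟨g', Set.support_indicator_subset, rfl⟩, ?_⟩
  rw [Lp.dist_def]
  have h1 : (f - c0ToLp p hS g' : PlaceSpace → ℝ) =ᵐ[avMeasure]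
      S.indicator (f - g : PlaceSpace → ℝ) := by
    filter_upwards [hf, c0ToLp_coeFn (p := p) hS g'] with y h2 h3
    rw [Pi.sub_apply, h3]
    by_cases hy : y ∈ S
    · simp [hy, g']
    · simp [hy, h2 hy]
  rw [eLpNorm_congr_ae h1, eLpNorm_indicator_eq_eLpNorm_restrict hS.measurableSet]
  refine (ENNReal.toReal_mono ENNReal.ofReal_ne_top hg).trans_lt ?_
  rw [ENNReal.toReal_ofReal (by positivity)]
  linarith

/-- Density of the `S`-units for the `L^p` norm. The map `R` projects `L^p` onto the functions with
integral zero on `S`, and it maps continuous functions into the closure of the `S`-units. -/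
lemma lpHyperplane_subset_closure [Fact (1 ≤ p)] (hp : p ≠ ∞) (hS : IsCompact S) (hSo : IsOpen S)
    (harch : PlaceSpace.archimedean ⊆ S) :
    lpHyperplane p S ⊆ closure (lpClasses p (sUnitFun S : Set (PlaceSpace → ℝ))) := by
  intro f hf
  set m := avMeasure.real PlaceSpace.archimedean
  have hm0 : 0 < m := avMeasure_real_archimedean_pos hS harch
  let R : Lp ℝ p avMeasure → Lp ℝ p avMeasure := fun f =>
    f - ((∫ y in S, f y ∂avMeasure) / m) • c0ToLp p hS (archC0 hS harch)
  have hR : Continuous R :=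
    continuous_id.sub (((continuous_setIntegral_lp hS).div_const m).smul continuous_const)
  have hRf : R f = f := by simp [R, hf.2]
  rw [← hRf, ← closure_closure]
  refine map_mem_closure hR (mem_closure_c0ToLp_image hp hS hSo hf.1) ?_
  rintro _ ⟨g, hg, rfl⟩
  have h1 : R (c0ToLp p hS g) = c0ToLp p hS
      (g - ((∫ y in S, g y ∂avMeasure) / m) • archC0 hS harch) := by
    simp only [R]
    rw [setIntegral_c0ToLp, map_sub, map_smul]
  rw [h1]
  refine c0ToLp_mem_closure hS (c0Hyperplane_subset_closure hS hSo harch ?_)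
  rw [mem_c0Hyperplane_iff hS.isClosed]
  refine ⟨fun y hy => ?_, ?_⟩
  · have h2 : g y = 0 := by
      by_contra hne
      exact hy (hg hne)
    have h3 : y ∉ PlaceSpace.archimedean := fun h => hy (harch h)
    simp [h2, archC0, h3]
  · simp only [ZeroAtInftyContinuousMap.coe_sub, ZeroAtInftyContinuousMap.coe_smul, Pi.sub_apply,
      Pi.smul_apply, smul_eq_mul]
    rw [integral_sub (integrableOn_c0 hS g) ((integrableOn_c0 hS _).const_mul _),
      integral_const_mul]
    have h4 : ∫ y in S, archC0 hS harch y ∂avMeasure = m := setIntegral_indicator_archimedean harch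
    rw [h4, div_mul_cancel₀ _ hm0.ne', sub_self]

end

end

/-- For a compact open set `S` of places of `Qbar` containing the archimedean ones, the space of
algebraic `S`-units lies in `F_p(S, 0) = {f ∈ F_p | supp f ⊆ S, ∫_S f = 0}`, which is closed, and
is dense in it (together: its closure is `F_p(S, 0)`); moreover `F_p(S, 0)` consists of all the
functions in `L^p` (in `C₀` for `p = ∞`) with support in `S` and integral zero. -/
theorem theorem1 (S : Set PlaceSpace) (hcompact : IsCompact S) (hopen : IsOpen S)
    (harch : PlaceSpace.archimedean ⊆ S) :
    (∀ (p : ℝ≥0∞) [Fact (1 ≤ p)], p ≠ ∞ →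
      closure (lpClasses p (sUnitFun S : Set (PlaceSpace → ℝ))) =
        weilSpace p ∩ lpHyperplane p S ∧
      lpHyperplane p S ⊆ weilSpace p) ∧
    (closure (c0Functions (sUnitFun S : Set (PlaceSpace → ℝ))) =
        weilSpaceTop ∩ c0Hyperplane S ∧
      c0Hyperplane S ⊆ weilSpaceTop) := by
  constructor
  · intro p _ hp
    have hdense := lpHyperplane_subset_closure hp hcompact hopen harch
    have hmono : closure (lpClasses p (sUnitFun S : Set (PlaceSpace → ℝ))) ⊆ weilSpace p :=
      closure_mono fun g ⟨f, hf, hgf⟩ => ⟨f, hf.1, hgf⟩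
    refine ⟨Set.Subset.antisymm (Set.subset_inter hmono ?_) fun f hf => hdense hf.2,
      hdense.trans hmono⟩
    exact closure_minimal (lpClasses_subset_lpHyperplane hcompact) (isClosed_lpHyperplane hcompact)
  · have hdense := c0Hyperplane_subset_closure hcompact hopen harch
    have hmono : closure (c0Functions (sUnitFun S : Set (PlaceSpace → ℝ))) ⊆ weilSpaceTop :=
      closure_mono fun g hg => hg.1
    refine ⟨Set.Subset.antisymm (Set.subset_inter hmono ?_) fun f hf => hdense hf.2,
      hdense.trans hmono⟩
    exact closure_minimal (sUnitC0_subset_c0Hyperplane hcompact) (isClosed_c0Hyperplane hcompact)
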